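/- Let $\mathcal A$ be a complete abelian category with exact products. For a small category $\mathcal C$, let $\Delta/\mathcal C$ be its simplex category: objects are pairs $([n],f)$ with $f:[n]\to\mathcal C$ a functor, and morphisms $([n],f)\to([m],g)$ are the morphisms $\sigma:[n]\to[m]$ of $\Delta$ with $f=g\circ\sigma$. For a functor $T:\Delta/\mathcal C\to\mathcal A$ (a Thomason natural system), the Thomason cohomology $H^n_{Th}(\mathcal C,T)$ is the $n$-th cohomology of the cochain complex $$C^n_{Th}(\mathcal C,T)=\prod_{[n]\xrightarrow{f}\mathcal C}T(f),\qquad d=\sum_{i=0}^{n+1}(-1)^i d_i,$$ where the component of $d_i$ at $g:[n+1]\to\mathcal C$ is the projection onto the factor $T(g\circ\delta^i)$ followed by $(\delta^i)_*:T(g\circ\delta^i)\to T(g)$. Let $\overline{\mathrm{Hom}}_{\Delta/\mathcal C}(-,T):\mathrm{Fun}(\Delta/\mathcal C,\mathfrak{Ab})^{op}\to\mathcal A$ be the symbolic hom functor, i.e. the right adjoint of $A\mapsto \mathrm{Hom}_{\mathcal A}(A,T(-))$, and let $\mathrm{Ext}^n_{\Delta/\mathcal C}(-,T)$ be its derived functors,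 so that $\mathrm{Ext}^n_{\Delta/\mathcal C}(\underline{\mathbb Z},T)=H^n\bigl(\overline{\mathrm{Hom}}_{\Delta/\mathcal C}(P_*,T)\bigr)$ for a projective resolution $P_*$ of the constant functor $\underline{\mathbb Z}$. Let $\lim^n_{\Delta/\mathcal C}$, also written $H^n(\Delta/\mathcal C,-)$, be the right derived functors (right satellites) of $\lim_{\Delta/\mathcal C}:\mathrm{Fun}(\Delta/\mathcal C,\mathcal A)\to\mathcal A$, i.e. the universal cohomological $\delta$-functor with degree-zero part $\lim_{\Delta/\mathcal C}$. Then the derived limits $\lim^n_{\Delta/\mathcal C}$ exist for every small category $\mathcal C$, and for every $n\ge 0$ there are isomorphisms, natural in $\mathcal C$ and in $T:\Delta/\mathcal C\to\mathcal A$, $$H^n_{Th}(\mathcal C,T)\;\cong\;\mathrm{Ext}^n_{\Delta/\mathcal C}(\underline{\mathbb Z},T)\;\cong\;{\lim}^n_{\Delta/\mathcal C}T=H^n(\Delta/\mathcal C,T).$$ Here naturality in $\mathcal C$ and $T$ means naturality on the category whose objects are the pairs $(\mathcal C,T)$ and whose morphisms $(\mathcal C_1,T_1)\to(\mathcal C_2,T_2)$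 are the pairs $(\varphi,\tau)$ of a functor $\varphi:\mathcal C_2\to\mathcal C_1$ and a natural transformation $\tau:T_1\circ\Delta/\varphi\to T_2$. -/

import Mathlib

open CategoryTheory CategoryTheory.Limits Opposite

attribute [-instance] CategoryTheory.catToReflQuiver

universe w u v₁ v₂ v₃ u₁ u₂ u₃

noncomputable section

namespace Thomason

/-! ### The simplex category and Thomason natural systems -/

/-- Objects of the simplex category `Δ/C`: pairs `([n], f)` with `f : [n] ⥤ C` a functor. -/
structure SimplexCat (C : Type w) [SmallCategory C] : Type w where
  dim : SimplexCategory
  simplex : Fin (dim.len + 1) ⥤ C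

section SimplexCat

variable {C : Type w} [SmallCategory C]

/-- A morphism `σ : [n] ⟶ [m]` of the standard simplex category, regarded as a functor. -/
def toFunctor {n m : SimplexCategory} (σ : n ⟶ m) : Fin (n.len + 1) ⥤ Fin (m.len + 1) :=
  σ.toOrderHom.monotone.functor

/-- A morphism `([n], f) ⟶ ([m], g)` in `Δ/C`: a morphism `σ : [n] ⟶ [m]` with `f = g ∘ σ`. -/
@[ext]
structure SimplexCat.Hom (f g : SimplexCat C) : Type w where
  map : f.dim ⟶ g.dim
  comm : f.simplex = toFunctor map ⋙ g.simplex

instance : SmallCategory (SimplexCat C) where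
  Hom f g := SimplexCat.Hom f g
  id f := ⟨𝟙 f.dim, rfl⟩
  comp {f g h} a b := ⟨a.map ≫ b.map, by rw [a.comm, b.comm]; rfl⟩

@[ext]
theorem SimplexCat.hom_ext {f g : SimplexCat C} {a b : f ⟶ g} (h : a.map = b.map) : a = b :=
  SimplexCat.Hom.ext h

@[simp]
theorem SimplexCat.id_map (f : SimplexCat C) : SimplexCat.Hom.map (𝟙 f) = 𝟙 f.dim := rfl

@[simp]
theorem SimplexCat.comp_map {f g h : SimplexCat C} (a : f ⟶ g) (b : g ⟶ h) :
    (a ≫ b).map = a.map ≫ b.map := rfl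

/-- The morphism `([n], g ∘ σ) ⟶ ([m], g)` of `Δ/C` given by `σ : [n] ⟶ [m]`. -/
def SimplexCat.pull {n m : SimplexCategory} (σ : n ⟶ m) (g : Fin (m.len + 1) ⥤ C) :
    (⟨n, toFunctor σ ⋙ g⟩ : SimplexCat C) ⟶ ⟨m, g⟩ :=
  SimplexCat.Hom.mk σ rfl

/-- The functor `Δ/φ : Δ/C ⥤ Δ/D` induced by a functor `φ : C ⥤ D`, `f ↦ φ ∘ f`. -/
def SimplexCat.mapFunctor {D : Type w} [SmallCategory D] (φ : C ⥤ D) :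
    SimplexCat C ⥤ SimplexCat D where
  obj f := ⟨f.dim, f.simplex ⋙ φ⟩
  map {f g} a := SimplexCat.Hom.mk a.map (by rw [a.comm]; rfl)

end SimplexCat

/-- A Thomason natural system with values in `A`: a small category `C` together with a functor
`T : Δ/C ⥤ A`. These are the objects of the category of Thomason natural systems. -/
structure NatSystem (A : Type u) [Category.{w} A] : Type (max u (w + 1)) where
  base : Type w
  [cat : SmallCategory base]
  system : SimplexCat base ⥤ A

attribute [instance] NatSystem.cat

/-- A morphism `(φ, τ) : T₁ ⟶ T₂` of Thomason natural systems: a functor `φ : C₂ ⥤ C₁` and a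
natural transformation `τ : T₁ ∘ Δ/φ ⟶ T₂`. -/
structure NatSystem.Hom {A : Type u} [Category.{w} A] (S T : NatSystem A) : Type w where
  functor : T.base ⥤ S.base
  trans : SimplexCat.mapFunctor functor ⋙ S.system ⟶ T.system

instance (A : Type u) [Category.{w} A] : Category.{w} (NatSystem A) where
  Hom S T := NatSystem.Hom S T
  id S := ⟨𝟭 S.base,
    { app := fun f => 𝟙 (S.system.obj f)
      naturality := fun _ _ x => (Category.comp_id _).trans (Category.id_comp (S.system.map x)).symm }⟩
  comp {R S T} a b := ⟨b.functor ⋙ a.functor,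
    { app := fun f => a.trans.app ((SimplexCat.mapFunctor b.functor).obj f) ≫ b.trans.app f
      naturality := fun f g x => (Functor.whiskerLeft (SimplexCat.mapFunctor b.functor) a.trans ≫
        b.trans).naturality x }⟩
  id_comp a := by
    refine congrArg (NatSystem.Hom.mk a.functor) (NatTrans.ext (funext fun f => ?_))
    exact Category.id_comp _
  comp_id a := by
    refine congrArg (NatSystem.Hom.mk a.functor) (NatTrans.ext (funext fun f => ?_))
    exact Category.comp_id _
  assoc a b c := by
    refine congrArg (NatSystem.Hom.mk (c.functor ⋙ b.functor ⋙ a.functor))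
      (NatTrans.ext (funext fun f => ?_))
    exact Category.assoc _ _ _

section NatSystem

variable {A : Type u} [Category.{w} A]

@[simp]
theorem NatSystem.id_functor (S : NatSystem A) : NatSystem.Hom.functor (𝟙 S) = 𝟭 S.base := rfl

@[simp]
theorem NatSystem.comp_functor {R S T : NatSystem A} (a : R ⟶ S) (b : S ⟶ T) :
    (a ≫ b).functor = b.functor ⋙ a.functor := rfl

/-- The component `τ_g : T₁ (φ ∘ g) ⟶ T₂ g` of a morphism `(φ, τ)` at `g : [n] ⥤ C₂`. -/
def NatSystem.Hom.at {S T : NatSystem A} (a : S ⟶ T) {n : SimplexCategory}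
    (g : Fin (n.len + 1) ⥤ T.base) :
    S.system.obj ⟨n, g ⋙ a.functor⟩ ⟶ T.system.obj ⟨n, g⟩ :=
  a.trans.app ⟨n, g⟩

theorem NatSystem.Hom.at_naturality {S T : NatSystem A} (a : S ⟶ T) {n m : SimplexCategory}
    (σ : n ⟶ m) (g : Fin (m.len + 1) ⥤ T.base) :
    S.system.map (SimplexCat.pull σ (g ⋙ a.functor)) ≫ a.at g =
      a.at (toFunctor σ ⋙ g) ≫ T.system.map (SimplexCat.pull σ g) :=
  a.trans.naturality (SimplexCat.pull σ g)

theorem NatSystem.id_at (S : NatSystem A) {n : SimplexCategory} (g : Fin (n.len + 1) ⥤ S.base) :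
    NatSystem.Hom.at (𝟙 S) g = 𝟙 (S.system.obj ⟨n, g⟩) := rfl

theorem NatSystem.comp_at {R S T : NatSystem A} (a : R ⟶ S) (b : S ⟶ T) {n : SimplexCategory}
    (g : Fin (n.len + 1) ⥤ T.base) :
    NatSystem.Hom.at (a ≫ b) g = a.at (g ⋙ b.functor) ≫ b.at g := rfl

end NatSystem

/-! ### Thomason cohomology -/

section Thomason

variable {A : Type u} [Category.{w} A] [HasProducts.{w} A]

/-- The cosimplicial replacement `∏^* T` of a Thomason natural system `T : Δ/C ⥤ A`. For
`σ : [n] ⟶ [m]`, the component of the structure map at `g : [m] ⥤ C` is the projection onto the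
component at `g ∘ σ` followed by `σ_* : T (g ∘ σ) ⟶ T g`. -/
def cosimplicialReplacement {C : Type w} [SmallCategory C] (T : SimplexCat C ⥤ A) :
    CosimplicialObject A where
  obj n := ∏ᶜ fun f : Fin (n.len + 1) ⥤ C => T.obj ⟨n, f⟩
  map {n m} σ := Pi.lift fun g => Pi.π (fun f : Fin (n.len + 1) ⥤ C => T.obj ⟨n, f⟩)
    (toFunctor σ ⋙ g) ≫ T.map (SimplexCat.pull σ g)
  map_id n := by
    refine Pi.hom_ext _ _ fun g => ?_
    rw [Pi.lift_π, Category.id_comp]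
    exact (congrArg (_ ≫ ·) (T.map_id (⟨n, g⟩ : SimplexCat C))).trans (Category.comp_id _)
  map_comp {n m k} σ ρ := by
    refine Pi.hom_ext _ _ fun g => ?_
    rw [Pi.lift_π, Category.assoc, Pi.lift_π, Pi.lift_π_assoc, Category.assoc]
    refine congrArg (_ ≫ ·) ?_
    rw [← T.map_comp]
    rfl

/-- The cosimplicial replacement is functorial on the category of Thomason natural systems:
`(φ, τ)` acts by `(a_f)_f ↦ (τ_g (a_{φ ∘ g}))_g`. -/
def cosimplicialReplacementFunctor (A : Type u) [Category.{w} A] [HasProducts.{w} A] :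
    NatSystem A ⥤ CosimplicialObject A where
  obj S := cosimplicialReplacement S.system
  map {S T} a :=
    { app := fun n => Pi.lift fun g : Fin (n.len + 1) ⥤ T.base =>
        Pi.π (fun f : Fin (n.len + 1) ⥤ S.base => S.system.obj ⟨n, f⟩) (g ⋙ a.functor) ≫ a.at g
      naturality := fun n m σ => by
        refine Pi.hom_ext _ _ fun g => ?_
        have h := a.at_naturality σ g
        dsimp only [cosimplicialReplacement]
        rw [Category.assoc, Pi.lift_π, Pi.lift_π_assoc, Category.assoc, Category.assoc, Pi.lift_π,
          Pi.lift_π_assoc, Category.assoc]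
        exact congrArg (_ ≫ ·) h }
  map_id S := by
    ext n
    refine Pi.hom_ext _ _ fun g => ?_
    refine (Pi.lift_π _ _).trans ?_
    exact (Category.comp_id _).trans (Category.id_comp _).symm
  map_comp {R S T} a b := by
    ext n
    refine Pi.hom_ext _ _ fun g => ?_
    refine (Pi.lift_π _ _).trans ?_
    symm
    refine (Category.assoc _ _ _).trans ?_
    refine (congrArg (_ ≫ ·) (Pi.lift_π _ _)).trans ?_
    exact ((Category.assoc _ _ _).symm.trans (congrArg (· ≫ _) (Pi.lift_π _ _))).trans
      (Category.assoc _ _ _)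

end Thomason

section Cohomology

variable (A : Type u) [Category.{w} A] [Abelian A] [HasProducts.{w} A]

/-- The Thomason cochain complex `C_Th^*`, as a functor on Thomason natural systems. -/
def thomasonComplex : NatSystem A ⥤ CochainComplex A ℕ :=
  cosimplicialReplacementFunctor A ⋙ AlgebraicTopology.alternatingCofaceMapComplex A

/-- The `n`-th Thomason cohomology `H^n_Th(C, T)`, as a functor on Thomason natural systems. -/
def thomasonCohomology (n : ℕ) : NatSystem A ⥤ A :=
  thomasonComplex A ⋙ HomologicalComplex.homologyFunctor A (ComplexShape.up ℕ) n

/-- The `n`-th Thomason cochain object is the product of the `T f` over all `f : [n] ⥤ C`. -/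
theorem thomasonComplex_X (S : NatSystem A) (n : ℕ) :
    ((thomasonComplex A).obj S).X n =
      ∏ᶜ fun f : Fin (n + 1) ⥤ S.base => S.system.obj ⟨SimplexCategory.mk n, f⟩ := rfl

/-- The differential is `∑ i, (-1)^i d_i` where the component of `d_i` at `g : [n + 1] ⥤ C` is the
projection onto the component at `g ∘ δ^i` followed by `(δ^i)_*`. -/
theorem thomasonComplex_d (S : NatSystem A) (n : ℕ) :
    ((thomasonComplex A).obj S).d n (n + 1) = ∑ i : Fin (n + 2), (-1 : ℤ) ^ (i : ℕ) •
      Pi.lift fun g : Fin (n + 1 + 1) ⥤ S.base =>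
        Pi.π (fun f : Fin (n + 1) ⥤ S.base => S.system.obj ⟨SimplexCategory.mk n, f⟩)
          (toFunctor (SimplexCategory.δ i) ⋙ g) ≫
          S.system.map (SimplexCat.pull (SimplexCategory.δ i) g) :=
  CochainComplex.of_d _ (AlgebraicTopology.AlternatingCofaceMapComplex.objD
    (cosimplicialReplacement S.system)) n

end Cohomology

/-! ### The symbolic Hom functor -/

section SymbolicHom

variable {A : Type u} [Category.{w} A] [Preadditive A]

/-- The functor `X ↦ Hom_A(X, T(-))`, from `A` to `Fun(D, Ab)ᵒᵖ`. -/
def homInto {D : Type w} [SmallCategory D] (T : D ⥤ A) : A ⥤ (D ⥤ AddCommGrpCat.{w})ᵒᵖ where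
  obj X := op
    { obj := fun c => AddCommGrpCat.of (X ⟶ T.obj c)
      map := fun σ => AddCommGrpCat.ofHom
        { toFun := fun x => x ≫ T.map σ
          map_zero' := zero_comp
          map_add' := fun _ _ => Preadditive.add_comp _ _ _ _ _ _ }
      map_id := fun c => by ext x; simp
      map_comp := fun σ ρ => by ext x; simp }
  map {X Y} h := Quiver.Hom.op
    { app := fun c => AddCommGrpCat.ofHom
        { toFun := fun x => h ≫ x
          map_zero' := comp_zero
          map_add' := fun _ _ => Preadditive.comp_add _ _ _ _ _ _ }
      naturality := fun c d σ => by ext x; simp }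
  map_id X := by
    apply Quiver.Hom.unop_inj
    ext c x
    simp
  map_comp h k := by
    apply Quiver.Hom.unop_inj
    ext c x
    simp

variable {D : Type w} [SmallCategory D]

/-- The index set of the equations that single out the natural, additive families. -/
abbrev SymRel (M : D ⥤ AddCommGrpCat.{w}) : Type w :=
  (Σ p : D × D, (p.1 ⟶ p.2) × M.obj p.1) ⊕ (Σ c : D, M.obj c × M.obj c)

section Representing

variable [HasLimits A] (M : D ⥤ AddCommGrpCat.{w}) (T : D ⥤ A)

/-- The target object of an equation. -/
def symTarget : SymRel M → A
  | .inl ⟨p, _⟩ => T.obj p.2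
  | .inr ⟨c, _⟩ => T.obj c

/-- The left-hand sides of the equations. -/
def symLeft : ∀ r : SymRel M, (∏ᶜ fun i : (Σ c : D, M.obj c) => T.obj i.1) ⟶ symTarget M T r
  | .inl ⟨p, s⟩ => Pi.π (fun i : (Σ c : D, M.obj c) => T.obj i.1) ⟨p.2, M.map s.1 s.2⟩
  | .inr ⟨c, s⟩ => Pi.π (fun i : (Σ c : D, M.obj c) => T.obj i.1) ⟨c, s.1 + s.2⟩

/-- The right-hand sides of the equations. -/
def symRight : ∀ r : SymRel M, (∏ᶜ fun i : (Σ c : D, M.obj c) => T.obj i.1) ⟶ symTarget M T r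
  | .inl ⟨p, s⟩ => Pi.π (fun i : (Σ c : D, M.obj c) => T.obj i.1) ⟨p.1, s.2⟩ ≫ T.map s.1
  | .inr ⟨c, s⟩ => Pi.π (fun i : (Σ c : D, M.obj c) => T.obj i.1) ⟨c, s.1⟩ +
      Pi.π (fun i : (Σ c : D, M.obj c) => T.obj i.1) ⟨c, s.2⟩

/-- An object representing the natural additive families. -/
def symRep : A := equalizer (Pi.lift (symLeft M T)) (Pi.lift (symRight M T))

/-- The universal family. -/
def symRepProj (c : D) (x : M.obj c) : symRep M T ⟶ T.obj c :=
  equalizer.ι _ _ ≫ Pi.π (fun i : (Σ c : D, M.obj c) => T.obj i.1) ⟨c, x⟩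

theorem symRep_cond (r : SymRel M) :
    equalizer.ι (Pi.lift (symLeft M T)) (Pi.lift (symRight M T)) ≫ symLeft M T r =
      equalizer.ι (Pi.lift (symLeft M T)) (Pi.lift (symRight M T)) ≫ symRight M T r := by
  have h := equalizer.condition (Pi.lift (symLeft M T)) (Pi.lift (symRight M T)) =≫ Pi.π _ r
  simpa using h

theorem symRepProj_map {c d : D} (s : c ⟶ d) (x : M.obj c) :
    symRepProj M T d (M.map s x) = symRepProj M T c x ≫ T.map s :=
  (symRep_cond M T (.inl ⟨(c, d), s, x⟩)).trans (Category.assoc _ _ _).symm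

theorem symRepProj_add (c : D) (x y : M.obj c) :
    symRepProj M T c (x + y) = symRepProj M T c x + symRepProj M T c y :=
  (symRep_cond M T (.inr ⟨c, x, y⟩)).trans (Preadditive.comp_add _ _ _ _ _ _)

/-- The representability of the natural additive families. -/
def symRepEquiv (X : A) : ((homInto T).obj X ⟶ op M) ≃ (X ⟶ symRep M T) where
  toFun β := equalizer.lift (Pi.lift fun i : (Σ c : D, M.obj c) => (β.unop.app i.1 i.2 : X ⟶ _))
    (by
      refine Pi.hom_ext _ _ fun r => ?_
      rw [Category.assoc, Pi.lift_π, Category.assoc, Pi.lift_π]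
      rcases r with ⟨p, s⟩ | ⟨c, s⟩
      · refine (Pi.lift_π _ _).trans (Eq.trans ?_ (Pi.lift_π_assoc _ _ _).symm)
        exact ConcreteCategory.congr_hom (β.unop.naturality s.1) s.2
      · refine (Pi.lift_π _ _).trans (Eq.trans ?_ (Preadditive.comp_add _ _ _ _ _ _).symm)
        refine Eq.trans ?_ (congrArg₂ (· + ·) (Pi.lift_π _ _) (Pi.lift_π _ _)).symm
        exact map_add (β.unop.app c).hom s.1 s.2)
  invFun h := Quiver.Hom.op
    { app := fun c => AddCommGrpCat.ofHom (AddMonoidHom.mk'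
        (fun x => h ≫ symRepProj M T c x)
        (fun x y => by rw [symRepProj_add, Preadditive.comp_add]))
      naturality := fun c d s => by
        ext x
        exact (congrArg (h ≫ ·) (symRepProj_map M T s x)).trans (Category.assoc _ _ _).symm }
  left_inv β := by
    apply Quiver.Hom.unop_inj
    ext c x
    refine (equalizer.lift_ι_assoc _ _ _).trans (Pi.lift_π _ _)
  right_inv h := by
    refine equalizer.hom_ext (Pi.hom_ext _ _ fun i => ?_)
    rw [equalizer.lift_ι]
    exact (Pi.lift_π _ _).trans (Category.assoc _ _ _).symm

end Representing

instance [HasLimits A] (T : D ⥤ A) : (homInto T).IsLeftAdjoint :=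
  ⟨_, ⟨Adjunction.adjunctionOfEquivRight
    (fun X M => symRepEquiv M.unop T X) (by
      intro X' X M f g
      refine equalizer.hom_ext (Pi.hom_ext _ _ fun i => ?_)
      refine ((congrArg (· ≫ _) (equalizer.lift_ι _ _)).trans (Pi.lift_π _ _)).trans ?_
      refine Eq.symm ((Category.assoc _ _ _).trans ((Category.assoc _ _ _).trans ?_))
      refine congrArg (f ≫ ·) ?_
      exact (Category.assoc _ _ _).symm.trans
        ((congrArg (· ≫ _) (equalizer.lift_ι _ _)).trans (Pi.lift_π _ _)))⟩⟩

variable [HasLimits A]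

/-- The symbolic hom functor `Hom_D(-, T) : Fun(D, Ab)ᵒᵖ ⥤ A`: the right adjoint of
`X ↦ Hom_A(X, T(-))`. -/
def symHom (T : D ⥤ A) : (D ⥤ AddCommGrpCat.{w})ᵒᵖ ⥤ A := (homInto T).rightAdjoint

/-- The adjunction which defines the symbolic hom functor. -/
def symHomAdj (T : D ⥤ A) : homInto T ⊣ symHom T := Adjunction.ofIsLeftAdjoint (homInto T)

/-- Evaluation of the symbolic hom at an element `x ∈ M(c)`: the component of the counit of the
adjunction. -/
def symEval (T : D ⥤ A) (M : D ⥤ AddCommGrpCat.{w}) (c : D) (x : M.obj c) :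
    (symHom T).obj (op M) ⟶ T.obj c :=
  ((symHomAdj T).counit.app (op M)).unop.app c x

/-- The morphism `X ⟶ Hom_D(M, T)` adjoint to a natural transformation `M ⟶ Hom_A(X, T(-))`. -/
def symLift (T : D ⥤ A) (M : D ⥤ AddCommGrpCat.{w}) (X : A) (β : M ⟶ ((homInto T).obj X).unop) :
    X ⟶ (symHom T).obj (op M) :=
  (symHomAdj T).homEquiv X (op M) β.op

theorem symLift_eval (T : D ⥤ A) (M : D ⥤ AddCommGrpCat.{w}) (X : A)
    (β : M ⟶ ((homInto T).obj X).unop) (c : D) (x : M.obj c) :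
    symLift T M X β ≫ symEval T M c x = β.app c x := by
  have h := ((symHomAdj T).homEquiv X (op M)).symm_apply_apply β.op
  rw [Adjunction.homEquiv_counit] at h
  exact congrArg (fun γ : (homInto T).obj X ⟶ op M => γ.unop.app c x) h

theorem symHom_ext (T : D ⥤ A) (M : D ⥤ AddCommGrpCat.{w}) {X : A}
    {f g : X ⟶ (symHom T).obj (op M)}
    (h : ∀ (c : D) (x : M.obj c), f ≫ symEval T M c x = g ≫ symEval T M c x) : f = g := by
  apply ((symHomAdj T).homEquiv X (op M)).symm.injective
  rw [Adjunction.homEquiv_counit, Adjunction.homEquiv_counit]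
  apply Quiver.Hom.unop_inj
  ext c x
  exact h c x

theorem symEval_map (T : D ⥤ A) (M : D ⥤ AddCommGrpCat.{w}) {c d : D} (s : c ⟶ d) (x : M.obj c) :
    symEval T M d (M.map s x) = symEval T M c x ≫ T.map s :=
  ConcreteCategory.congr_hom (((symHomAdj T).counit.app (op M)).unop.naturality s) x

theorem symEval_add (T : D ⥤ A) (M : D ⥤ AddCommGrpCat.{w}) (c : D) (x y : M.obj c) :
    symEval T M c (x + y) = symEval T M c x + symEval T M c y :=
  map_add (((symHomAdj T).counit.app (op M)).unop.app c).hom x y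

theorem symHom_map_eval (T : D ⥤ A) {M N : D ⥤ AddCommGrpCat.{w}} (a : M ⟶ N) (c : D)
    (x : M.obj c) : (symHom T).map a.op ≫ symEval T M c x = symEval T N c (a.app c x) :=
  congrArg (fun γ : (homInto T).obj _ ⟶ op M => γ.unop.app c x)
    ((symHomAdj T).counit.naturality a.op)

instance (T : D ⥤ A) : (symHom T).Additive where
  map_add {M N f g} := by
    refine symHom_ext T N.unop fun c x => ?_
    rw [Preadditive.add_comp]
    refine (symHom_map_eval T (f.unop + g.unop) c x).trans ?_
    refine Eq.trans ?_ (congrArg₂ (· + ·) (symHom_map_eval T f.unop c x)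
      (symHom_map_eval T g.unop c x)).symm
    exact symEval_add T _ c (f.unop.app c x) (g.unop.app c x)

end SymbolicHom

/-! ### Ext groups with values in `A` -/

section EnoughProjectives

variable {D : Type w} [SmallCategory D]

/-- The functor `ℤ Hom_D(c, -) : D ⥤ Ab`. -/
def freeOn (c : D) : D ⥤ AddCommGrpCat.{w} where
  obj d := AddCommGrpCat.of (FreeAbelianGroup (c ⟶ d))
  map s := AddCommGrpCat.ofHom (FreeAbelianGroup.map fun r => r ≫ s)
  map_id d := by
    refine AddCommGrpCat.hom_ext (FreeAbelianGroup.lift_ext _ _ fun r => ?_)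
    simp
  map_comp s t := by
    refine AddCommGrpCat.hom_ext (FreeAbelianGroup.lift_ext _ _ fun r => ?_)
    simp

/-- The natural transformation `ℤ Hom_D(c, -) ⟶ M` determined by an element of `M(c)`. -/
def freeOnDesc (M : D ⥤ AddCommGrpCat.{w}) (c : D) (x : M.obj c) : freeOn c ⟶ M where
  app d := AddCommGrpCat.ofHom (FreeAbelianGroup.lift fun s : c ⟶ d => M.map s x)
  naturality d e s := by
    refine AddCommGrpCat.hom_ext (FreeAbelianGroup.lift_ext _ _ fun r => ?_)
    simp [freeOn]

theorem freeOnDesc_id (M : D ⥤ AddCommGrpCat.{w}) (c : D) (x : M.obj c) :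
    (freeOnDesc M c x).app c (FreeAbelianGroup.of (𝟙 c)) = x := by
  refine (FreeAbelianGroup.lift_apply_of _ _).trans ?_
  simp

theorem freeOn_hom_ext {M : D ⥤ AddCommGrpCat.{w}} {c : D} {a b : freeOn c ⟶ M}
    (h : a.app c (FreeAbelianGroup.of (𝟙 c)) = b.app c (FreeAbelianGroup.of (𝟙 c))) : a = b := by
  refine NatTrans.ext (funext fun d => AddCommGrpCat.hom_ext (FreeAbelianGroup.lift_ext _ _ fun r => ?_))
  have key : ∀ e : freeOn c ⟶ M, e.app d (FreeAbelianGroup.of r) =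
      M.map r (e.app c (FreeAbelianGroup.of (𝟙 c))) := fun e => by
    have h := ConcreteCategory.congr_hom (e.naturality r) (FreeAbelianGroup.of (𝟙 c))
    refine Eq.trans ?_ h
    refine congrArg (e.app d) ?_
    refine Eq.symm ((FreeAbelianGroup.map_of_apply _).trans ?_)
    rw [Category.id_comp]
  exact (key a).trans ((congrArg (M.map r) h).trans (key b).symm)

instance (c : D) : Projective (freeOn c) where
  factors {E X} f e _ := by
    have he : Function.Surjective (e.app c) :=
      (AddCommGrpCat.epi_iff_surjective _).1 inferInstance
    obtain ⟨x, hx⟩ := he (f.app c (FreeAbelianGroup.of (𝟙 c)))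
    refine ⟨freeOnDesc E c x, freeOn_hom_ext ?_⟩
    refine Eq.trans ?_ hx
    exact congrArg (e.app c) (freeOnDesc_id E c x)

instance : EnoughProjectives (D ⥤ AddCommGrpCat.{w}) where
  presentation M := ⟨
    { p := ∐ fun i : (Σ c : D, M.obj c) => freeOn i.1
      f := Sigma.desc fun i => freeOnDesc M i.1 i.2
      projective := inferInstance
      epi := by
        rw [NatTrans.epi_iff_epi_app]
        intro c
        rw [AddCommGrpCat.epi_iff_surjective]
        intro x
        refine ⟨(Sigma.ι (fun i : (Σ c : D, M.obj c) => freeOn i.1) ⟨c, x⟩).app c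
          (FreeAbelianGroup.of (𝟙 c)), ?_⟩
        refine Eq.trans ?_ (freeOnDesc_id M c x)
        have h := Sigma.ι_desc (fun i : (Σ c : D, M.obj c) => freeOnDesc M i.1 i.2) ⟨c, x⟩
        exact congrArg (fun γ : freeOn c ⟶ M => γ.app c (FreeAbelianGroup.of (𝟙 c))) h }⟩

end EnoughProjectives

section Lifting

variable {𝓐 : Type u₁} [Category.{v₁} 𝓐] [Abelian 𝓐]

/-- A chain complex `⋯ ⟶ Q₁ ⟶ Q₀` with an augmentation `Q₀ ⟶ Y` such that the augmented complex
is exact. -/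
structure ExactAug (Y : 𝓐) where
  complex : ChainComplex 𝓐 ℕ
  aug : complex.X 0 ⟶ Y
  w : complex.d 1 0 ≫ aug = 0
  epi : Epi aug
  exact₀ : (ShortComplex.mk _ _ w).Exact
  exact_succ (n : ℕ) : (ShortComplex.mk _ _ (complex.d_comp_d (n + 2) (n + 1) n)).Exact

/-- The augmentation of a projective resolution. -/
def resAug {X : 𝓐} (P : ProjectiveResolution X) : P.complex.X 0 ⟶ X := P.π.f 0

/-- A projective resolution as an exact augmented complex. -/
def ExactAug.ofRes {X : 𝓐} (P : ProjectiveResolution X) : ExactAug X where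
  complex := P.complex
  aug := resAug P
  w := P.complex_d_comp_π_f_zero
  epi := inferInstanceAs (Epi (P.π.f 0))
  exact₀ := P.exact₀
  exact_succ := P.exact_succ

/-- A morphism of chain complexes over a given morphism of the augmented objects. -/
def IsOver {X Y : 𝓐} (P : ProjectiveResolution X) (Q : ExactAug Y) (f : X ⟶ Y)
    (φ : P.complex ⟶ Q.complex) : Prop := φ.f 0 ≫ Q.aug = resAug P ≫ f

theorem exists_isOver {X Y : 𝓐} (P : ProjectiveResolution X) (Q : ExactAug Y) (f : X ⟶ Y) :
    ∃ φ : P.complex ⟶ Q.complex, IsOver P Q f φ := by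
  have := Q.epi
  let z : P.complex.X 0 ⟶ Q.complex.X 0 := Projective.factorThru (resAug P ≫ f) Q.aug
  have hz : z ≫ Q.aug = resAug P ≫ f := Projective.factorThru_comp _ _
  have hP : P.complex.d 1 0 ≫ resAug P = 0 := P.complex_d_comp_π_f_zero
  have h₁ : (P.complex.d 1 0 ≫ z) ≫ Q.aug = 0 := by
    rw [Category.assoc, hz, ← Category.assoc, hP, zero_comp]
  let o : P.complex.X 1 ⟶ Q.complex.X 1 := Q.exact₀.liftFromProjective (P.complex.d 1 0 ≫ z) h₁
  have ho : o ≫ Q.complex.d 1 0 = P.complex.d 1 0 ≫ z :=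
    Q.exact₀.liftFromProjective_comp (P.complex.d 1 0 ≫ z) h₁
  refine ⟨ChainComplex.mkHom _ _ z o ho fun n ⟨g, g', h⟩ =>
    ⟨(Q.exact_succ n).liftFromProjective (P.complex.d (n + 2) (n + 1) ≫ g') (by
      dsimp only
      rw [Category.assoc, h, ← Category.assoc, P.complex.d_comp_d, zero_comp]),
      (Q.exact_succ n).liftFromProjective_comp _ _⟩, ?_⟩
  refine Eq.trans ?_ hz
  exact congrArg (· ≫ Q.aug) (ChainComplex.mkHom_f_0 ..)

theorem nonempty_homotopy_zero {X Y : 𝓐} (P : ProjectiveResolution X) (Q : ExactAug Y)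
    (φ : P.complex ⟶ Q.complex) (h : φ.f 0 ≫ Q.aug = 0) : Nonempty (Homotopy φ 0) := by
  let z : P.complex.X 0 ⟶ Q.complex.X 1 := Q.exact₀.liftFromProjective (φ.f 0) h
  have hz : φ.f 0 = z ≫ Q.complex.d 1 0 := (Q.exact₀.liftFromProjective_comp (φ.f 0) h).symm
  have h₁ : (φ.f 1 - P.complex.d 1 0 ≫ z) ≫ Q.complex.d 1 0 = 0 := by
    rw [Preadditive.sub_comp, Category.assoc, ← hz, HomologicalComplex.Hom.comm, sub_self]
  let o : P.complex.X 1 ⟶ Q.complex.X 2 := (Q.exact_succ 0).liftFromProjective _ h₁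
  have ho : o ≫ Q.complex.d 2 1 = φ.f 1 - P.complex.d 1 0 ≫ z :=
    (Q.exact_succ 0).liftFromProjective_comp _ h₁
  exact ⟨Homotopy.mkInductive _ z hz o (by rw [ho]; abel) fun n ⟨g, g', hg⟩ =>
    ⟨(Q.exact_succ (n + 1)).liftFromProjective (φ.f (n + 2) - P.complex.d _ _ ≫ g') (by
      dsimp only
      rw [Preadditive.sub_comp, HomologicalComplex.Hom.comm, hg, Category.assoc,
        Preadditive.comp_add, ← Category.assoc, P.complex.d_comp_d, zero_comp, zero_add, sub_self]),
      by
        refine (sub_eq_iff_eq_add'.1 ?_)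
        exact ((Q.exact_succ (n + 1)).liftFromProjective_comp _ _).symm⟩⟩

theorem IsOver.nonempty_homotopy {X Y : 𝓐} {P : ProjectiveResolution X} {Q : ExactAug Y}
    {f : X ⟶ Y} {φ ψ : P.complex ⟶ Q.complex} (hφ : IsOver P Q f φ) (hψ : IsOver P Q f ψ) :
    Nonempty (Homotopy φ ψ) := by
  obtain ⟨h⟩ := nonempty_homotopy_zero P Q (φ - ψ) (by
    rw [HomologicalComplex.sub_f_apply, Preadditive.sub_comp, hφ, hψ, sub_self])
  exact ⟨Homotopy.equivSubZero.symm h⟩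

end Lifting

section Ext

variable {A : Type u} [Category.{w} A] [Abelian A] [HasLimits A]

/-- The cochain complex `Hom_D(P_*, T)` in `A`, for a chain complex `P_*` in `Fun(D, Ab)`. -/
def homComplex {D : Type w} [SmallCategory D] (T : D ⥤ A)
    (P : ChainComplex (D ⥤ AddCommGrpCat.{w}) ℕ) : CochainComplex A ℕ where
  X n := (symHom T).obj (op (P.X n))
  d i j := (symHom T).map (P.d j i).op
  shape i j h := by
    rw [P.shape j i h, op_zero]
    exact (symHom T).map_zero _ _
  d_comp_d' i j k _ _ := by
    rw [← Functor.map_comp, ← op_comp, P.d_comp_d, op_zero]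
    exact (symHom T).map_zero _ _

/-- The groups `Ext^n_D(M, T)` with values in `A`: the derived functors of the symbolic hom functor
`Hom_D(-, T) : Fun(D, Ab)ᵒᵖ ⥤ A`, computed by a projective resolution of `M`. -/
def symExt {D : Type w} [SmallCategory D] (n : ℕ) (M : D ⥤ AddCommGrpCat.{w}) (T : D ⥤ A) : A :=
  (homComplex T (projectiveResolution M).complex).homology n

/-- The constant functor `ℤ : D ⥤ Ab`. -/
def constZ (D : Type w) [SmallCategory D] : D ⥤ AddCommGrpCat.{w} :=
  (Functor.const D).obj (AddCommGrpCat.of (ULift.{w} ℤ))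

section ChangeOfCategory

variable {D₁ : Type w} [SmallCategory D₁] {D₂ : Type w} [SmallCategory D₂]

/-- The morphism `Hom(M₁, T₁) ⟶ Hom(M₂, T₂)` induced by a functor `Φ : D₂ ⥤ D₁` and natural
transformations `τ : T₁ ∘ Φ ⟶ T₂` and `α : M₂ ⟶ M₁ ∘ Φ`. -/
def symMap (Φ : D₂ ⥤ D₁) {T₁ : D₁ ⥤ A} {T₂ : D₂ ⥤ A} (τ : Φ ⋙ T₁ ⟶ T₂)
    {M₁ : D₁ ⥤ AddCommGrpCat.{w}} {M₂ : D₂ ⥤ AddCommGrpCat.{w}} (α : M₂ ⟶ Φ ⋙ M₁) :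
    (symHom T₁).obj (op M₁) ⟶ (symHom T₂).obj (op M₂) :=
  symLift T₂ M₂ _
    { app := fun c => AddCommGrpCat.ofHom (AddMonoidHom.mk'
        (fun x => symEval T₁ M₁ (Φ.obj c) (α.app c x) ≫ τ.app c)
        (fun x y => by
          rw [← Preadditive.add_comp]
          refine congrArg (· ≫ τ.app c) ?_
          exact (congrArg (symEval T₁ M₁ (Φ.obj c)) (map_add (α.app c).hom x y)).trans
            (symEval_add T₁ M₁ (Φ.obj c) _ _)))
      naturality := fun c d s => by
        ext x
        have h : α.app d (M₂.map s x) = M₁.map (Φ.map s) (α.app c x) :=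
          ConcreteCategory.congr_hom (α.naturality s) x
        have h' : T₁.map (Φ.map s) ≫ τ.app d = τ.app c ≫ T₂.map s := τ.naturality s
        change symEval T₁ M₁ (Φ.obj d) (α.app d (M₂.map s x)) ≫ τ.app d =
          (symEval T₁ M₁ (Φ.obj c) (α.app c x) ≫ τ.app c) ≫ T₂.map s
        rw [h, symEval_map, Category.assoc, h', Category.assoc] }

theorem symMap_eval (Φ : D₂ ⥤ D₁) {T₁ : D₁ ⥤ A} {T₂ : D₂ ⥤ A} (τ : Φ ⋙ T₁ ⟶ T₂)
    {M₁ : D₁ ⥤ AddCommGrpCat.{w}} {M₂ : D₂ ⥤ AddCommGrpCat.{w}} (α : M₂ ⟶ Φ ⋙ M₁) (c : D₂)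
    (x : M₂.obj c) :
    symMap Φ τ α ≫ symEval T₂ M₂ c x = symEval T₁ M₁ (Φ.obj c) (α.app c x) ≫ τ.app c :=
  symLift_eval T₂ M₂ _ _ c x

/-- Restriction of a chain complex of functors along `Φ`. -/
def restrict (Φ : D₂ ⥤ D₁) (P : ChainComplex (D₁ ⥤ AddCommGrpCat.{w}) ℕ) :
    ChainComplex (D₂ ⥤ AddCommGrpCat.{w}) ℕ where
  X n := Φ ⋙ P.X n
  d i j := Functor.whiskerLeft Φ (P.d i j)
  shape i j h := by rw [P.shape i j h]; rfl
  d_comp_d' i j k _ _ := by rw [← Functor.whiskerLeft_comp, P.d_comp_d]; rfl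

/-- The cochain map `Hom(P₁, T₁) ⟶ Hom(P₂, T₂)` induced by `Φ`, `τ : T₁ ∘ Φ ⟶ T₂` and a chain map
`α : P₂ ⟶ P₁ ∘ Φ`. -/
def homComplexMap (Φ : D₂ ⥤ D₁) {T₁ : D₁ ⥤ A} {T₂ : D₂ ⥤ A} (τ : Φ ⋙ T₁ ⟶ T₂)
    {P₁ : ChainComplex (D₁ ⥤ AddCommGrpCat.{w}) ℕ} {P₂ : ChainComplex (D₂ ⥤ AddCommGrpCat.{w}) ℕ}
    (α : P₂ ⟶ restrict Φ P₁) : homComplex T₁ P₁ ⟶ homComplex T₂ P₂ where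
  f n := symMap Φ τ (α.f n)
  comm' i j _ := by
    refine symHom_ext T₂ _ fun c x => ?_
    have h : (α.f i).app c ((P₂.d j i).app c x) = (P₁.d j i).app (Φ.obj c) ((α.f j).app c x) :=
      (congrArg (fun γ : P₂.X j ⟶ Φ ⋙ P₁.X i => γ.app c x) (α.comm j i)).symm
    refine (Category.assoc _ _ _).trans ((congrArg (_ ≫ ·) (symHom_map_eval T₂ _ c x)).trans ?_)
    refine (symMap_eval Φ τ _ c _).trans ?_
    refine Eq.symm ((Category.assoc _ _ _).trans
      ((congrArg (_ ≫ ·) (symMap_eval Φ τ _ c x)).trans ?_))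
    refine (Category.assoc _ _ _).symm.trans (congrArg (· ≫ τ.app c) ?_)
    refine (symHom_map_eval T₁ (P₁.d j i) (Φ.obj c) _).trans ?_
    exact congrArg (symEval T₁ (P₁.X i) (Φ.obj c)) h.symm

theorem symMap_eq_comp (Φ : D₂ ⥤ D₁) {T₁ : D₁ ⥤ A} {T₂ : D₂ ⥤ A} (τ : Φ ⋙ T₁ ⟶ T₂)
    {M₁ : D₁ ⥤ AddCommGrpCat.{w}} {M₂ : D₂ ⥤ AddCommGrpCat.{w}} (α : M₂ ⟶ Φ ⋙ M₁) :
    symMap Φ τ α = symMap Φ τ (𝟙 (Φ ⋙ M₁)) ≫ (symHom T₂).map α.op := by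
  refine symHom_ext T₂ _ fun c x => ?_
  rw [symMap_eval, Category.assoc, symHom_map_eval, symMap_eval]
  rfl

theorem symMap_add (Φ : D₂ ⥤ D₁) {T₁ : D₁ ⥤ A} {T₂ : D₂ ⥤ A} (τ : Φ ⋙ T₁ ⟶ T₂)
    {M₁ : D₁ ⥤ AddCommGrpCat.{w}} {M₂ : D₂ ⥤ AddCommGrpCat.{w}} (α β : M₂ ⟶ Φ ⋙ M₁) :
    symMap Φ τ (α + β) = symMap Φ τ α + symMap Φ τ β := by
  rw [symMap_eq_comp, symMap_eq_comp Φ τ α, symMap_eq_comp Φ τ β, ← Preadditive.comp_add, op_add,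
    Functor.map_add]

theorem symMap_zero (Φ : D₂ ⥤ D₁) {T₁ : D₁ ⥤ A} {T₂ : D₂ ⥤ A} (τ : Φ ⋙ T₁ ⟶ T₂)
    (M₁ : D₁ ⥤ AddCommGrpCat.{w}) (M₂ : D₂ ⥤ AddCommGrpCat.{w}) :
    symMap Φ τ (0 : M₂ ⟶ Φ ⋙ M₁) = 0 := by
  rw [symMap_eq_comp, op_zero, Functor.map_zero, comp_zero]

theorem d_symMap (Φ : D₂ ⥤ D₁) {T₁ : D₁ ⥤ A} {T₂ : D₂ ⥤ A} (τ : Φ ⋙ T₁ ⟶ T₂)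
    {M₁ N₁ : D₁ ⥤ AddCommGrpCat.{w}} {M₂ : D₂ ⥤ AddCommGrpCat.{w}} (a : M₁ ⟶ N₁)
    (α : M₂ ⟶ Φ ⋙ M₁) :
    (symHom T₁).map a.op ≫ symMap Φ τ α = symMap Φ τ (α ≫ Functor.whiskerLeft Φ a) := by
  refine symHom_ext T₂ _ fun c x => ?_
  rw [Category.assoc, symMap_eval, ← Category.assoc, symHom_map_eval, symMap_eval]
  rfl

theorem symMap_d (Φ : D₂ ⥤ D₁) {T₁ : D₁ ⥤ A} {T₂ : D₂ ⥤ A} (τ : Φ ⋙ T₁ ⟶ T₂)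
    {M₁ : D₁ ⥤ AddCommGrpCat.{w}} {M₂ N₂ : D₂ ⥤ AddCommGrpCat.{w}} (a : M₂ ⟶ N₂)
    (α : N₂ ⟶ Φ ⋙ M₁) :
    symMap Φ τ α ≫ (symHom T₂).map a.op = symMap Φ τ (a ≫ α) := by
  refine symHom_ext T₂ _ fun c x => ?_
  rw [Category.assoc, symHom_map_eval, symMap_eval, symMap_eval]
  rfl

/-- Homotopic chain maps induce homotopic cochain maps. -/
def homComplexMapHomotopy (Φ : D₂ ⥤ D₁) {T₁ : D₁ ⥤ A} {T₂ : D₂ ⥤ A} (τ : Φ ⋙ T₁ ⟶ T₂)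
    {P₁ : ChainComplex (D₁ ⥤ AddCommGrpCat.{w}) ℕ} {P₂ : ChainComplex (D₂ ⥤ AddCommGrpCat.{w}) ℕ}
    {α β : P₂ ⟶ restrict Φ P₁} (h : Homotopy α β) :
    Homotopy (homComplexMap Φ τ α) (homComplexMap Φ τ β) where
  hom i j := symMap Φ τ (h.hom j i)
  zero i j hij := by
    rw [h.zero j i hij]
    exact symMap_zero Φ τ _ _
  comm i := by
    have hc := h.comm i
    rcases i with _ | i
    · rw [Homotopy.dNext_zero_chainComplex, zero_add, Homotopy.prevD_chainComplex] at hc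
      refine Eq.trans ?_ (congrArg (· + symMap Φ τ (β.f 0)) (congrArg₂ (· + ·)
        (Homotopy.dNext_cochainComplex _ _) (Homotopy.prevD_zero_cochainComplex _))).symm
      refine Eq.trans ?_ (congrArg (· + symMap Φ τ (β.f 0)) (add_zero _)).symm
      refine (congrArg (symMap Φ τ) hc).trans ((symMap_add Φ τ _ _).trans ?_)
      exact congrArg (· + symMap Φ τ (β.f 0)) (d_symMap Φ τ _ _).symm
    · rw [Homotopy.dNext_succ_chainComplex, Homotopy.prevD_chainComplex] at hc
      refine Eq.trans ?_ (congrArg (· + symMap Φ τ (β.f (i + 1))) (congrArg₂ (· + ·)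
        (Homotopy.dNext_cochainComplex _ _) (Homotopy.prevD_succ_cochainComplex _ _))).symm
      refine (congrArg (symMap Φ τ) hc).trans ((symMap_add Φ τ _ _).trans ?_)
      refine congrArg (· + symMap Φ τ (β.f (i + 1))) ((symMap_add Φ τ _ _).trans ?_)
      refine (add_comm _ _).trans ?_
      exact congrArg₂ (· + ·) (d_symMap Φ τ _ _).symm (symMap_d Φ τ _ _).symm

/-- The restriction of a projective resolution along `Φ` is exact. -/
def restrictRes (Φ : D₂ ⥤ D₁) {M : D₁ ⥤ AddCommGrpCat.{w}} (P : ProjectiveResolution M) :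
    ExactAug (Φ ⋙ M) where
  complex := restrict Φ P.complex
  aug := Functor.whiskerLeft Φ (resAug P)
  w := ((ShortComplex.mk (P.complex.d 1 0) (resAug P) P.complex_d_comp_π_f_zero).map
    ((Functor.whiskeringLeft D₂ D₁ AddCommGrpCat.{w}).obj Φ)).zero
  epi := by
    have : Epi (resAug P) := inferInstanceAs (Epi (P.π.f 0))
    exact inferInstanceAs (Epi (((Functor.whiskeringLeft D₂ D₁ AddCommGrpCat.{w}).obj Φ).map
      (resAug P)))
  exact₀ := P.exact₀.map ((Functor.whiskeringLeft D₂ D₁ AddCommGrpCat.{w}).obj Φ)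
  exact_succ n := (P.exact_succ n).map ((Functor.whiskeringLeft D₂ D₁ AddCommGrpCat.{w}).obj Φ)

/-- Chain maps `P₂ ⟶ P₁ ∘ Φ` of resolutions of the constant functors `ℤ` over the identity
of `ℤ`. -/
def IsComparison (Φ : D₂ ⥤ D₁) (P₁ : ProjectiveResolution (constZ D₁))
    (P₂ : ProjectiveResolution (constZ D₂)) (α : P₂.complex ⟶ restrict Φ P₁.complex) : Prop :=
  IsOver P₂ (restrictRes Φ P₁) (𝟙 (constZ D₂)) α

/-- A chosen comparison map between the chosen resolutions of `ℤ`. -/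
def comparison (Φ : D₂ ⥤ D₁) : (projectiveResolution (constZ D₂)).complex ⟶
    restrict Φ (projectiveResolution (constZ D₁)).complex :=
  (exists_isOver (projectiveResolution (constZ D₂))
    (restrictRes Φ (projectiveResolution (constZ D₁))) (𝟙 (constZ D₂))).choose

theorem isComparison_comparison (Φ : D₂ ⥤ D₁) :
    IsComparison Φ (projectiveResolution (constZ D₁)) (projectiveResolution (constZ D₂))
      (comparison Φ) :=
  (exists_isOver (projectiveResolution (constZ D₂))
    (restrictRes Φ (projectiveResolution (constZ D₁))) (𝟙 (constZ D₂))).choose_spec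

/-- All comparison maps induce the same map in cohomology. -/
theorem homologyMap_homComplexMap_eq (Φ : D₂ ⥤ D₁) {T₁ : D₁ ⥤ A} {T₂ : D₂ ⥤ A} (τ : Φ ⋙ T₁ ⟶ T₂)
    {P₁ : ProjectiveResolution (constZ D₁)} {P₂ : ProjectiveResolution (constZ D₂)}
    {α β : P₂.complex ⟶ restrict Φ P₁.complex} (hα : IsComparison Φ P₁ P₂ α)
    (hβ : IsComparison Φ P₁ P₂ β) (n : ℕ) :
    HomologicalComplex.homologyMap (homComplexMap Φ τ α) n =
      HomologicalComplex.homologyMap (homComplexMap Φ τ β) n := by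
  obtain ⟨h⟩ := IsOver.nonempty_homotopy hα hβ
  exact (homComplexMapHomotopy Φ τ h).homologyMap_eq n

/-- The morphism `Ext^n_{D₁}(ℤ, T₁) ⟶ Ext^n_{D₂}(ℤ, T₂)` induced by `Φ : D₂ ⥤ D₁` and
`τ : T₁ ∘ Φ ⟶ T₂`. -/
def extMap (n : ℕ) (Φ : D₂ ⥤ D₁) {T₁ : D₁ ⥤ A} {T₂ : D₂ ⥤ A} (τ : Φ ⋙ T₁ ⟶ T₂) :
    symExt n (constZ D₁) T₁ ⟶ symExt n (constZ D₂) T₂ :=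
  HomologicalComplex.homologyMap (homComplexMap Φ τ (comparison Φ)) n

end ChangeOfCategory

end Ext

section Comparison

variable {A : Type u} [Category.{w} A]

/-- The identity as a comparison map. -/
def idComparison (S : NatSystem A) (P : ChainComplex (SimplexCat S.base ⥤ AddCommGrpCat.{w}) ℕ) :
    P ⟶ restrict (SimplexCat.mapFunctor (NatSystem.Hom.functor (𝟙 S))) P where
  f n := { app := fun f => 𝟙 ((P.X n).obj f)
           naturality := fun f g x => (𝟙 (P.X n) : P.X n ⟶ P.X n).naturality x }
  comm' i j _ := by
    ext f : 2
    exact (Category.id_comp _).trans (Category.comp_id _).symm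

theorem isComparison_id (S : NatSystem A) (P : ProjectiveResolution (constZ (SimplexCat S.base))) :
    IsComparison (SimplexCat.mapFunctor (NatSystem.Hom.functor (𝟙 S))) P P
      (idComparison S P.complex) := by
  refine NatTrans.ext (funext fun c => ?_)
  exact (Category.id_comp _).trans (Category.comp_id _).symm

/-- The composition of comparison maps. -/
def compComparison {R S T : NatSystem A} (a : R ⟶ S) (b : S ⟶ T)
    {P : ChainComplex (SimplexCat R.base ⥤ AddCommGrpCat.{w}) ℕ}
    {Q : ChainComplex (SimplexCat S.base ⥤ AddCommGrpCat.{w}) ℕ}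
    {Q' : ChainComplex (SimplexCat T.base ⥤ AddCommGrpCat.{w}) ℕ}
    (α : Q ⟶ restrict (SimplexCat.mapFunctor a.functor) P)
    (β : Q' ⟶ restrict (SimplexCat.mapFunctor b.functor) Q) :
    Q' ⟶ restrict (SimplexCat.mapFunctor (a ≫ b).functor) P where
  f n :=
    { app := fun f => (β.f n).app f ≫ (α.f n).app ((SimplexCat.mapFunctor b.functor).obj f)
      naturality := fun f g x =>
        (β.f n ≫ Functor.whiskerLeft (SimplexCat.mapFunctor b.functor) (α.f n)).naturality x }
  comm' i j _ := by
    ext f : 2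
    have h₁ := congrArg (fun γ => NatTrans.app γ f) (β.comm i j)
    have h₂ := congrArg (fun γ => NatTrans.app γ ((SimplexCat.mapFunctor b.functor).obj f))
      (α.comm i j)
    refine (Category.assoc _ _ _).trans ((congrArg (_ ≫ ·) h₂).trans ?_)
    exact (Category.assoc _ _ _).symm.trans ((congrArg (· ≫ _) h₁).trans (Category.assoc _ _ _))

theorem isComparison_comp {R S T : NatSystem A} (a : R ⟶ S) (b : S ⟶ T)
    {P : ProjectiveResolution (constZ (SimplexCat R.base))}
    {Q : ProjectiveResolution (constZ (SimplexCat S.base))}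
    {Q' : ProjectiveResolution (constZ (SimplexCat T.base))}
    {α : Q.complex ⟶ restrict (SimplexCat.mapFunctor a.functor) P.complex}
    {β : Q'.complex ⟶ restrict (SimplexCat.mapFunctor b.functor) Q.complex}
    (hα : IsComparison _ P Q α) (hβ : IsComparison _ Q Q' β) :
    IsComparison (SimplexCat.mapFunctor (a ≫ b).functor) P Q' (compComparison a b α β) := by
  refine NatTrans.ext (funext fun f => ?_)
  have h₁ := congrArg (fun γ => NatTrans.app γ f) hβ
  have h₂ := congrArg (fun γ => NatTrans.app γ ((SimplexCat.mapFunctor b.functor).obj f)) hα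
  refine (Category.assoc _ _ _).trans ((congrArg (_ ≫ ·) (h₂.trans (Category.comp_id _))).trans ?_)
  exact h₁

end Comparison

section Ext

variable {A : Type u} [Category.{w} A] [Abelian A] [HasLimits A]

theorem homComplexMap_id (S : NatSystem A)
    (P : ChainComplex (SimplexCat S.base ⥤ AddCommGrpCat.{w}) ℕ) :
    homComplexMap (SimplexCat.mapFunctor (NatSystem.Hom.functor (𝟙 S)))
      (NatSystem.Hom.trans (𝟙 S)) (idComparison S P) = 𝟙 (homComplex S.system P) := by
  ext n
  refine symHom_ext S.system _ fun c x => (symMap_eval _ _ _ c x).trans ?_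
  exact (Category.comp_id _).trans (Category.id_comp _).symm

theorem homComplexMap_comp {R S T : NatSystem A} (a : R ⟶ S) (b : S ⟶ T)
    {P : ChainComplex (SimplexCat R.base ⥤ AddCommGrpCat.{w}) ℕ}
    {Q : ChainComplex (SimplexCat S.base ⥤ AddCommGrpCat.{w}) ℕ}
    {Q' : ChainComplex (SimplexCat T.base ⥤ AddCommGrpCat.{w}) ℕ}
    (α : Q ⟶ restrict (SimplexCat.mapFunctor a.functor) P)
    (β : Q' ⟶ restrict (SimplexCat.mapFunctor b.functor) Q) :
    homComplexMap (SimplexCat.mapFunctor (a ≫ b).functor) (a ≫ b).trans (compComparison a b α β) =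
      homComplexMap _ a.trans α ≫ homComplexMap _ b.trans β := by
  ext n
  refine symHom_ext T.system _ fun c x => (symMap_eval _ _ _ c x).trans ?_
  refine Eq.symm ((Category.assoc _ _ _).trans ((congrArg (_ ≫ ·) (symMap_eval _ _ _ c x)).trans ?_))
  refine (Category.assoc _ _ _).symm.trans ((congrArg (· ≫ _) (symMap_eval _ _ _ _ _)).trans ?_)
  exact Category.assoc _ _ _

/-- `Ext^n_{Δ/C}(ℤ, T)`, as a functor on the category of Thomason natural systems. -/
def extFunctor (A : Type u) [Category.{w} A] [Abelian A] [HasLimits A] (n : ℕ) :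
    NatSystem A ⥤ A where
  obj S := symExt n (constZ (SimplexCat S.base)) S.system
  map a := extMap n (SimplexCat.mapFunctor a.functor) a.trans
  map_id S := by
    refine (homologyMap_homComplexMap_eq _ _ (isComparison_comparison _)
      (isComparison_id S _) n).trans ?_
    rw [homComplexMap_id, HomologicalComplex.homologyMap_id]
    rfl
  map_comp a b := by
    refine (homologyMap_homComplexMap_eq _ _ (isComparison_comparison _)
      (isComparison_comp a b (isComparison_comparison _) (isComparison_comparison _)) n).trans ?_
    rw [homComplexMap_comp, HomologicalComplex.homologyMap_comp]
    rfl

end Ext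
/-! ### Cohomological δ-functors and derived functors -/

section DeltaFunctor

/-- A (cohomological, exact) δ-functor `F⁰, F¹, …` from `𝓐` to `𝓑`: additive functors together with
natural connecting morphisms such that every short exact sequence `0 ⟶ X₁ ⟶ X₂ ⟶ X₃ ⟶ 0` has an exact
sequence `0 ⟶ F⁰ X₁ ⟶ F⁰ X₂ ⟶ F⁰ X₃ ⟶ F¹ X₁ ⟶ F¹ X₂ ⟶ ⋯`. -/
structure DeltaFunctor (𝓐 : Type u₁) [Category.{v₁} 𝓐] [Abelian 𝓐] (𝓑 : Type u₂) [Category.{v₂} 𝓑]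
    [Abelian 𝓑] where
  F : ℕ → 𝓐 ⥤ 𝓑
  [additive : ∀ n, (F n).Additive]
  δ (n : ℕ) (S : ShortComplex 𝓐) (hS : S.ShortExact) : (F n).obj S.X₃ ⟶ (F (n + 1)).obj S.X₁
  δ_naturality (n : ℕ) {S S' : ShortComplex 𝓐} (hS : S.ShortExact) (hS' : S'.ShortExact)
    (φ : S ⟶ S') : (F n).map φ.τ₃ ≫ δ n S' hS' = δ n S hS ≫ (F (n + 1)).map φ.τ₁
  map_comp_δ (n : ℕ) (S : ShortComplex 𝓐) (hS : S.ShortExact) : (F n).map S.g ≫ δ n S hS = 0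
  δ_comp_map (n : ℕ) (S : ShortComplex 𝓐) (hS : S.ShortExact) : δ n S hS ≫ (F (n + 1)).map S.f = 0
  mono (S : ShortComplex 𝓐) (hS : S.ShortExact) : Mono ((F 0).map S.f)
  exact₂ (n : ℕ) (S : ShortComplex 𝓐) (hS : S.ShortExact) : (S.map (F n)).Exact
  exact₃ (n : ℕ) (S : ShortComplex 𝓐) (hS : S.ShortExact) :
    (ShortComplex.mk _ _ (map_comp_δ n S hS)).Exact
  exact₁ (n : ℕ) (S : ShortComplex 𝓐) (hS : S.ShortExact) :
    (ShortComplex.mk _ _ (δ_comp_map n S hS)).Exact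

attribute [instance] DeltaFunctor.additive

variable {𝓐 : Type u₁} [Category.{v₁} 𝓐] [Abelian 𝓐] {𝓑 : Type u₂} [Category.{v₂} 𝓑] [Abelian 𝓑]

/-- A morphism of δ-functors: natural transformations `Fⁿ ⟶ Gⁿ` compatible with the connecting
morphisms. -/
@[ext]
structure DeltaFunctor.Hom (F G : DeltaFunctor 𝓐 𝓑) where
  app (n : ℕ) : F.F n ⟶ G.F n
  comm (n : ℕ) (S : ShortComplex 𝓐) (hS : S.ShortExact) :
    F.δ n S hS ≫ (app (n + 1)).app S.X₁ = (app n).app S.X₃ ≫ G.δ n S hS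

/-- A δ-functor is universal if every natural transformation `F⁰ ⟶ G⁰` to the degree `0` part of a
δ-functor `G` extends uniquely to a morphism of δ-functors. -/
def DeltaFunctor.IsUniversal (F : DeltaFunctor 𝓐 𝓑) : Prop :=
  ∀ (G : DeltaFunctor 𝓐 𝓑) (f : F.F 0 ⟶ G.F 0), ∃! φ : DeltaFunctor.Hom F G, φ.app 0 = f

/-- The right derived functors (right satellites) of a functor `L : 𝓐 ⥤ 𝓑`: a universal δ-functor
together with an isomorphism of its degree `0` part with `L`. They are unique up to unique
isomorphism. This notion needs no injective objects. -/
structure RightDerived (L : 𝓐 ⥤ 𝓑) where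
  delta : DeltaFunctor 𝓐 𝓑
  universal : delta.IsUniversal
  iso : delta.F 0 ≅ L

/-- Restriction of a δ-functor along an exact functor. -/
def DeltaFunctor.precomp {𝓒 : Type u₃} [Category.{v₃} 𝓒] [Abelian 𝓒] (E : 𝓒 ⥤ 𝓐) [E.Additive]
    [PreservesFiniteLimits E] [PreservesFiniteColimits E] (F : DeltaFunctor 𝓐 𝓑) :
    DeltaFunctor 𝓒 𝓑 where
  F n := E ⋙ F.F n
  δ n S hS := F.δ n (S.map E) (hS.map_of_exact E)
  δ_naturality n _ _ hS hS' φ := F.δ_naturality n (hS.map_of_exact E) (hS'.map_of_exact E)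
    (E.mapShortComplex.map φ)
  map_comp_δ n S hS := F.map_comp_δ n (S.map E) (hS.map_of_exact E)
  δ_comp_map n S hS := F.δ_comp_map n (S.map E) (hS.map_of_exact E)
  mono S hS := F.mono (S.map E) (hS.map_of_exact E)
  exact₂ n S hS := F.exact₂ n (S.map E) (hS.map_of_exact E)
  exact₃ n S hS := F.exact₃ n (S.map E) (hS.map_of_exact E)
  exact₁ n S hS := F.exact₁ n (S.map E) (hS.map_of_exact E)

/-- The unique morphism of δ-functors extending a given natural transformation in degree `0`. -/
def DeltaFunctor.IsUniversal.lift {F : DeltaFunctor 𝓐 𝓑} (h : F.IsUniversal)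
    (G : DeltaFunctor 𝓐 𝓑) (f : F.F 0 ⟶ G.F 0) : DeltaFunctor.Hom F G := (h G f).choose

theorem DeltaFunctor.IsUniversal.lift_zero {F : DeltaFunctor 𝓐 𝓑} (h : F.IsUniversal)
    (G : DeltaFunctor 𝓐 𝓑) (f : F.F 0 ⟶ G.F 0) : (h.lift G f).app 0 = f := (h G f).choose_spec.1

theorem DeltaFunctor.IsUniversal.hom_ext {F : DeltaFunctor 𝓐 𝓑} (h : F.IsUniversal)
    {G : DeltaFunctor 𝓐 𝓑} {φ ψ : DeltaFunctor.Hom F G} (h₀ : φ.app 0 = ψ.app 0) : φ = ψ :=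
  (h G (ψ.app 0)).unique h₀ rfl

end DeltaFunctor

section DerivedLimit

variable {A : Type u} [Category.{w} A] [Abelian A] [HasLimits A]

section

variable {D₁ : Type w} [SmallCategory D₁] {D₂ : Type w} [SmallCategory D₂]

/-- The natural morphism `lim_{D₁} T ⟶ lim_{D₂} (T ∘ Φ)`. -/
def limPre (A : Type u) [Category.{w} A] [HasLimits A] (Φ : D₂ ⥤ D₁) :
    (lim : (D₁ ⥤ A) ⥤ A) ⟶ (Functor.whiskeringLeft D₂ D₁ A).obj Φ ⋙ lim where
  app T := limit.pre T Φ
  naturality T T' τ := by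
    refine limit.hom_ext fun d => ?_
    simp

/-- The morphism of δ-functors `lim^n_{D₁} T ⟶ lim^n_{D₂} (T ∘ Φ)` which extends the natural morphism
of limits. -/
def limRestrict (Φ : D₂ ⥤ D₁) (L₁ : RightDerived (lim : (D₁ ⥤ A) ⥤ A))
    (L₂ : RightDerived (lim : (D₂ ⥤ A) ⥤ A)) :
    DeltaFunctor.Hom L₁.delta (L₂.delta.precomp ((Functor.whiskeringLeft D₂ D₁ A).obj Φ)) :=
  L₁.universal.lift _ (L₁.iso.hom ≫ limPre A Φ ≫
    Functor.whiskerLeft ((Functor.whiskeringLeft D₂ D₁ A).obj Φ) L₂.iso.inv)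

theorem limRestrict_zero (Φ : D₂ ⥤ D₁) (L₁ : RightDerived (lim : (D₁ ⥤ A) ⥤ A))
    (L₂ : RightDerived (lim : (D₂ ⥤ A) ⥤ A)) (T : D₁ ⥤ A) :
    ((limRestrict Φ L₁ L₂).app 0).app T =
      L₁.iso.hom.app T ≫ limit.pre T Φ ≫ L₂.iso.inv.app (Φ ⋙ T) :=
  congrArg (fun γ => NatTrans.app γ T) (L₁.universal.lift_zero _ _)

end

/-- A choice of derived limits `lim^n_{Δ/C}`, for all small categories `C`. -/
abbrev DerivedLimits (A : Type u) [Category.{w} A] [Abelian A] [HasLimits A] :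
    Type (max u (w + 1)) :=
  ∀ (C : Type w) [SmallCategory C], RightDerived (lim : (SimplexCat C ⥤ A) ⥤ A)

/-- The identity as a morphism of δ-functors. -/
def limRestrictId (S : NatSystem A) (L : RightDerived (lim : (SimplexCat S.base ⥤ A) ⥤ A)) :
    DeltaFunctor.Hom L.delta (L.delta.precomp ((Functor.whiskeringLeft _ _ A).obj
      (SimplexCat.mapFunctor (NatSystem.Hom.functor (𝟙 S))))) where
  app n :=
    { app := fun T => 𝟙 ((L.delta.F n).obj T)
      naturality := fun _ _ τ => (𝟙 (L.delta.F n) : L.delta.F n ⟶ L.delta.F n).naturality τ }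
  comm _ _ _ := (Category.comp_id _).trans (Category.id_comp _).symm

/-- The composition of two restriction morphisms. -/
def limRestrictComp (L : DerivedLimits A) {R S T : NatSystem A} (a : R ⟶ S) (b : S ⟶ T) :
    DeltaFunctor.Hom (L R.base).delta ((L T.base).delta.precomp ((Functor.whiskeringLeft _ _ A).obj
      (SimplexCat.mapFunctor (a ≫ b).functor))) where
  app n :=
    { app := fun X =>
        ((limRestrict (SimplexCat.mapFunctor a.functor) (L R.base) (L S.base)).app n).app X ≫
        ((limRestrict (SimplexCat.mapFunctor b.functor) (L S.base) (L T.base)).app n).app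
          (SimplexCat.mapFunctor a.functor ⋙ X)
      naturality := fun X X' τ =>
        ((limRestrict (SimplexCat.mapFunctor a.functor) (L R.base) (L S.base)).app n ≫
        Functor.whiskerLeft ((Functor.whiskeringLeft _ _ A).obj (SimplexCat.mapFunctor a.functor))
          ((limRestrict (SimplexCat.mapFunctor b.functor) (L S.base)
            (L T.base)).app n)).naturality τ }
  comm n Q hQ := by
    have h₁ := (limRestrict (SimplexCat.mapFunctor a.functor) (L R.base) (L S.base)).comm n Q hQ
    have h₂ := (limRestrict (SimplexCat.mapFunctor b.functor) (L S.base) (L T.base)).comm n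
      (Q.map ((Functor.whiskeringLeft _ _ A).obj (SimplexCat.mapFunctor a.functor)))
      (hQ.map_of_exact _)
    refine (Category.assoc _ _ _).symm.trans ((congrArg (· ≫ _) h₁).trans ?_)
    exact (Category.assoc _ _ _).trans ((congrArg (_ ≫ ·) h₂).trans (Category.assoc _ _ _).symm)

theorem limRestrict_id (S : NatSystem A) (L : RightDerived (lim : (SimplexCat S.base ⥤ A) ⥤ A)) :
    limRestrict (SimplexCat.mapFunctor (NatSystem.Hom.functor (𝟙 S))) L L = limRestrictId S L := by
  refine L.universal.hom_ext (NatTrans.ext (funext fun T => ?_))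
  refine (limRestrict_zero _ L L T).trans ?_
  have h : limit.pre T (SimplexCat.mapFunctor (NatSystem.Hom.functor (𝟙 S))) = 𝟙 (limit T) :=
    limit.hom_ext fun d => (limit.pre_π _ _ _).trans (Category.id_comp _).symm
  refine (congrArg (fun γ => L.iso.hom.app T ≫ γ ≫ L.iso.inv.app T) h).trans ?_
  exact (congrArg (_ ≫ ·) (Category.id_comp _)).trans (L.iso.hom_inv_id_app T)

theorem limRestrict_comp (L : DerivedLimits A) {R S T : NatSystem A} (a : R ⟶ S) (b : S ⟶ T) :
    limRestrict (SimplexCat.mapFunctor (a ≫ b).functor) (L R.base) (L T.base) =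
      limRestrictComp L a b := by
  refine (L R.base).universal.hom_ext (NatTrans.ext (funext fun X => ?_))
  refine (limRestrict_zero _ _ _ X).trans ?_
  refine Eq.symm ((congrArg₂ (· ≫ ·) (limRestrict_zero _ _ _ X) (limRestrict_zero _ _ _ _)).trans ?_)
  have h : limit.pre X (SimplexCat.mapFunctor a.functor) ≫
      limit.pre (SimplexCat.mapFunctor a.functor ⋙ X) (SimplexCat.mapFunctor b.functor) =
      limit.pre X (SimplexCat.mapFunctor (a ≫ b).functor) :=
    limit.hom_ext fun d => by
      refine (Category.assoc _ _ _).trans ((congrArg (_ ≫ ·) (limit.pre_π _ _ _)).trans ?_)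
      exact (limit.pre_π _ _ _).trans
        (limit.pre_π X (SimplexCat.mapFunctor (a ≫ b).functor) d).symm
  refine (Category.assoc _ _ _).trans (congrArg (_ ≫ ·) ?_)
  refine (Category.assoc _ _ _).trans ?_
  refine (congrArg (_ ≫ ·) ((L S.base).iso.inv_hom_id_app_assoc _ _)).trans ?_
  exact (Category.assoc _ _ _).symm.trans (congrArg (· ≫ _) h)

/-- The derived limit `lim^n_{Δ/C} T`, as a functor on the category of Thomason natural systems. A
morphism `(φ, τ)` induces the composite `lim^n T₁ ⟶ lim^n (T₁ ∘ Δ/φ) ⟶ lim^n T₂`. -/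
def DerivedLimits.functor (L : DerivedLimits A) (n : ℕ) : NatSystem A ⥤ A where
  obj S := ((L S.base).delta.F n).obj S.system
  map {S T} a :=
    ((limRestrict (SimplexCat.mapFunctor a.functor) (L S.base) (L T.base)).app n).app S.system ≫
      ((L T.base).delta.F n).map a.trans
  map_id S := by
    have h := congrArg (fun γ => (DeltaFunctor.Hom.app γ n).app S.system) (limRestrict_id S (L S.base))
    refine (congrArg (· ≫ _) h).trans ?_
    refine (Category.id_comp _).trans ?_
    exact ((L S.base).delta.F n).map_id S.system
  map_comp {R S T} a b := by
    have h := congrArg (fun γ => (DeltaFunctor.Hom.app γ n).app R.system) (limRestrict_comp L a b)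
    refine (congrArg (· ≫ _) h).trans ?_
    have h₁ := ((limRestrict (SimplexCat.mapFunctor b.functor) (L S.base)
      (L T.base)).app n).naturality a.trans
    have h₂ : ((L T.base).delta.F n).map (a ≫ b).trans = ((L T.base).delta.F n).map
        (Functor.whiskerLeft (SimplexCat.mapFunctor b.functor) a.trans) ≫
        ((L T.base).delta.F n).map b.trans :=
      ((L T.base).delta.F n).map_comp
        (Functor.whiskerLeft (SimplexCat.mapFunctor b.functor) a.trans) b.trans
    refine (congrArg (_ ≫ ·) h₂).trans ?_
    refine (Category.assoc _ _ _).trans (Eq.trans ?_ (Category.assoc _ _ _).symm)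
    refine congrArg (_ ≫ ·) ?_
    refine (Category.assoc _ _ _).symm.trans (Eq.trans ?_ (Category.assoc _ _ _))
    exact congrArg (· ≫ _) h₁.symm

end DerivedLimit

end Thomason

end

/-!
On `Δ/C` let `Bₙ` be the system `f ↦ ℤ[Δ^{dim f}]ₙ`. A generator of `Bₙ f` is a morphism
`σ : [n] ⟶ dim f`, that is, a morphism `f ∘ σ ⟶ f` of `Δ/C`; hence `Bₙ` is the direct sum of the
representable systems of all the `n`-simplices of `C`. By the Yoneda lemma it is projective and the
symbolic hom out of it is `∏_f T f`, so that the symbolic hom complex of `B` is the Thomason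
complex. The extra degeneracy of the standard simplices contracts every `B f` onto `ℤ`, so `B` is a
projective resolution of the constant system.

Since products in `A` are exact, Thomason cohomology on a fixed `C` is a δ-functor, and its degree
`0` part is the limit because every simplex is joined to its vertices and any two vertices of a
simplex are joined by an edge. A system embeds in the coinduced system `c ↦ ∏_{c ⟶ d} T d`, whose
Thomason complex is a product of complexes `Hom(ℤ[Δ^{dim d}], T d)` and so is killed in positive
degrees by the same extra degeneracy. By Grothendieck's theorem the δ-functor is universal, and its
naturality in `C` need only be checked in degree `0`.
-/

noncomputable section

namespace Thomason

section DeltaFunctors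

variable {𝓐 : Type u₁} [Category.{v₁} 𝓐] [Abelian 𝓐] {𝓑 : Type u₂} [Category.{v₂} 𝓑] [Abelian 𝓑]
  {𝓒 : Type u₃} [Category.{v₃} 𝓒] [Abelian 𝓒]

namespace DeltaFunctor

instance : Category (DeltaFunctor 𝓐 𝓑) where
  Hom := DeltaFunctor.Hom
  id F := { app n := 𝟙 (F.F n), comm := by simp }
  comp φ ψ :=
    { app n := φ.app n ≫ ψ.app n
      comm n S hS := by
        simp only [NatTrans.comp_app, Category.assoc, ← ψ.comm]
        rw [← Category.assoc, φ.comm, Category.assoc] }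

/-- Evaluation of δ-functors in degree `n`. -/
def degree (𝓐 : Type u₁) [Category.{v₁} 𝓐] [Abelian 𝓐] (𝓑 : Type u₂) [Category.{v₂} 𝓑]
    [Abelian 𝓑] (n : ℕ) : DeltaFunctor 𝓐 𝓑 ⥤ 𝓐 ⥤ 𝓑 where
  obj F := F.F n
  map φ := φ.app n

/-- Restriction along an exact functor, as a functor on δ-functors. -/
def precompFunctor (𝓑 : Type u₂) [Category.{v₂} 𝓑] [Abelian 𝓑] (E : 𝓒 ⥤ 𝓐) [E.Additive]
    [PreservesFiniteLimits E] [PreservesFiniteColimits E] :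
    DeltaFunctor 𝓐 𝓑 ⥤ DeltaFunctor 𝓒 𝓑 where
  obj F := F.precomp E
  map φ :=
    { app n := Functor.whiskerLeft E (φ.app n)
      comm n S hS := φ.comm n (S.map E) (hS.map_of_exact E) }

theorem IsUniversal.lift_comp {F G H : DeltaFunctor 𝓐 𝓑} (hF : F.IsUniversal) (f : F.F 0 ⟶ G.F 0)
    (φ : G ⟶ H) : (hF.lift G f ≫ φ : F ⟶ H) = hF.lift H (f ≫ φ.app 0) := by
  refine hF.hom_ext ?_
  rw [hF.lift_zero]
  exact congrArg (· ≫ φ.app 0) (hF.lift_zero G f)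

theorem IsUniversal.comp_lift {F G H : DeltaFunctor 𝓐 𝓑} (hF : F.IsUniversal)
    (hG : G.IsUniversal) (φ : F ⟶ G) (f : G.F 0 ⟶ H.F 0) :
    (φ ≫ hG.lift H f : F ⟶ H) = hF.lift H (φ.app 0 ≫ f) := by
  refine hF.hom_ext ?_
  rw [hF.lift_zero]
  exact congrArg (φ.app 0 ≫ ·) (hG.lift_zero H f)

theorem IsUniversal.lift_id {F : DeltaFunctor 𝓐 𝓑} (hF : F.IsUniversal) :
    hF.lift F (𝟙 (F.F 0)) = 𝟙 F :=
  hF.hom_ext (hF.lift_zero F _)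

/-- Universal δ-functors with isomorphic degree `0` parts are isomorphic. -/
def IsUniversal.isoOfIsoZero {F G : DeltaFunctor 𝓐 𝓑} (hF : F.IsUniversal) (hG : G.IsUniversal)
    (e : F.F 0 ≅ G.F 0) : F ≅ G where
  hom := hF.lift G e.hom
  inv := hG.lift F e.inv
  hom_inv_id := by rw [hF.lift_comp, hG.lift_zero, e.hom_inv_id, hF.lift_id]
  inv_hom_id := by rw [hG.lift_comp, hF.lift_zero, e.inv_hom_id, hG.lift_id]

end DeltaFunctor

/-! ### Effaceable δ-functors are universal -/

/-- A morphism of short complexes given by its first two components, when the source is right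
exact. -/
def homOfShortExact {S S' : ShortComplex 𝓐} (hS : S.ShortExact) (f : S.X₁ ⟶ S'.X₁)
    (g : S.X₂ ⟶ S'.X₂) (w : f ≫ S'.f = S.f ≫ g) : S ⟶ S' :=
  have := hS.epi_g
  { τ₁ := f
    τ₂ := g
    τ₃ := hS.exact.desc (g ≫ S'.g) (by
      rw [← Category.assoc, ← w, Category.assoc, S'.zero, comp_zero])
    comm₁₂ := w
    comm₂₃ := (hS.exact.g_desc _ _).symm }

theorem shortExact_mk_cokernel {X Y : 𝓐} (u : X ⟶ Y) [Mono u] :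
    (ShortComplex.mk u (cokernel.π u) (cokernel.condition u)).ShortExact where
  exact := ShortComplex.exact_cokernel u

namespace DeltaFunctor

/-- A δ-functor is effaceable if every object embeds in one on which a given positive degree is
killed. -/
def IsEffaceable (F : DeltaFunctor 𝓐 𝓑) : Prop :=
  ∀ (n : ℕ) (X : 𝓐), ∃ (Y : 𝓐) (u : X ⟶ Y), Mono u ∧ (F.F (n + 1)).map u = 0

variable {F G : DeltaFunctor 𝓐 𝓑} {n : ℕ}

theorem epi_δ {S : ShortComplex 𝓐} (hS : S.ShortExact) (h₀ : (F.F (n + 1)).map S.f = 0) :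
    Epi (F.δ n S hS) :=
  (F.exact₁ n S hS).epi_f h₀

/-- `t` makes the square formed by the connecting morphisms of a short exact sequence, the
transformation `a` in degree `n` and `t` commute. -/
def Intertwines (a : F.F n ⟶ G.F n) {S : ShortComplex 𝓐} (hS : S.ShortExact)
    (t : (F.F (n + 1)).obj S.X₁ ⟶ (G.F (n + 1)).obj S.X₁) : Prop :=
  F.δ n S hS ≫ t = a.app S.X₃ ≫ G.δ n S hS

theorem exists_intertwines (a : F.F n ⟶ G.F n) {S : ShortComplex 𝓐} (hS : S.ShortExact)
    (h₀ : (F.F (n + 1)).map S.f = 0) : ∃ t, Intertwines a hS t := by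
  have := epi_δ hS h₀
  have h : (F.F n).map S.g ≫ a.app S.X₃ ≫ G.δ n S hS = 0 := by
    rw [a.naturality_assoc, G.map_comp_δ, comp_zero]
  exact ⟨(F.exact₃ n S hS).desc _ h, (F.exact₃ n S hS).g_desc _ h⟩

theorem Intertwines.naturality {a : F.F n ⟶ G.F n} {S S' : ShortComplex 𝓐} {hS : S.ShortExact}
    {hS' : S'.ShortExact} {t : (F.F (n + 1)).obj S.X₁ ⟶ (G.F (n + 1)).obj S.X₁}
    {t' : (F.F (n + 1)).obj S'.X₁ ⟶ (G.F (n + 1)).obj S'.X₁} (ht : Intertwines a hS t)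
    (ht' : Intertwines a hS' t') (φ : S ⟶ S') (h₀ : (F.F (n + 1)).map S.f = 0) :
    (F.F (n + 1)).map φ.τ₁ ≫ t' = t ≫ (G.F (n + 1)).map φ.τ₁ := by
  have := epi_δ hS h₀
  rw [← cancel_epi (F.δ n S hS)]
  calc
    _ = (F.F n).map φ.τ₃ ≫ F.δ n S' hS' ≫ t' := by
      rw [← Category.assoc, ← F.δ_naturality n hS hS' φ, Category.assoc]
    _ = a.app S.X₃ ≫ (G.F n).map φ.τ₃ ≫ G.δ n S' hS' := by rw [ht', a.naturality_assoc]
    _ = _ := by rw [G.δ_naturality n hS hS' φ, ← Category.assoc, ← ht, Category.assoc]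

theorem Intertwines.map_comp {a : F.F n ⟶ G.F n} {X X' Y Y' : 𝓐} {u : X ⟶ Y} [Mono u]
    {u' : X' ⟶ Y'} [Mono u'] {t : (F.F (n + 1)).obj X ⟶ (G.F (n + 1)).obj X}
    {t' : (F.F (n + 1)).obj X' ⟶ (G.F (n + 1)).obj X'}
    (ht : Intertwines a (shortExact_mk_cokernel u) t)
    (ht' : Intertwines a (shortExact_mk_cokernel u') t') (hu : (F.F (n + 1)).map u = 0)
    (hu' : (F.F (n + 1)).map u' = 0) (f : X ⟶ X') :
    (F.F (n + 1)).map f ≫ t' = t ≫ (G.F (n + 1)).map f := by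
  -- `X ⟶ Y ⊞ Y'` is effaced too, and its sequence maps to those of both `u` and `u'`.
  let v : X ⟶ Y ⊞ Y' := biprod.lift u (f ≫ u')
  have : Mono v := mono_of_mono_fac (biprod.lift_fst u (f ≫ u'))
  have hv : (F.F (n + 1)).map v = 0 := by
    have : v = u ≫ biprod.inl + f ≫ u' ≫ biprod.inr := by ext <;> simp [v]
    simp [this, hu, hu', Functor.map_add]
  have hS := shortExact_mk_cokernel v
  obtain ⟨s, hs⟩ := exists_intertwines a hS hv
  have hst : s = t := by
    simpa [homOfShortExact] using
      (hs.naturality ht (homOfShortExact hS (𝟙 X) biprod.fst (by simp [v])) hv).symm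
  subst hst
  exact hs.naturality ht' (homOfShortExact hS f biprod.snd (by simp [v])) hv

namespace IsEffaceable

theorem exists_extension (hF : F.IsEffaceable) (a : F.F n ⟶ G.F n) :
    ∃ b : F.F (n + 1) ⟶ G.F (n + 1), ∀ (S : ShortComplex 𝓐) (hS : S.ShortExact),
      Intertwines a hS (b.app S.X₁) := by
  choose Y u hu hu₀ using hF n
  choose t ht using fun X => exists_intertwines a (shortExact_mk_cokernel (u X)) (hu₀ X)
  refine ⟨{ app := t, naturality := fun X X' f => (ht X).map_comp (ht X') (hu₀ X) (hu₀ X') f },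
    fun S hS => ?_⟩
  have := hS.mono_f
  let v : S.X₁ ⟶ Y S.X₂ := S.f ≫ u S.X₂
  have hv : (F.F (n + 1)).map v = 0 := by rw [Functor.map_comp, hu₀, comp_zero]
  have hS' := shortExact_mk_cokernel v
  obtain ⟨s, hs⟩ := exists_intertwines a hS' hv
  have hst : t S.X₁ = s := by simpa using hs.map_comp (ht S.X₁) hv (hu₀ S.X₁) (𝟙 S.X₁)
  let φ := homOfShortExact (S' := .mk v _ (cokernel.condition v)) hS (𝟙 S.X₁) (u S.X₂)
    (Category.id_comp _)
  have hF' := F.δ_naturality n hS hS' φ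
  have hG' := G.δ_naturality n hS hS' φ
  calc F.δ n S hS ≫ t S.X₁ = (F.F n).map φ.τ₃ ≫ F.δ n _ hS' ≫ s := by
        rw [hst, ← Category.assoc, hF']; simp [φ, homOfShortExact]
    _ = a.app S.X₃ ≫ (G.F n).map φ.τ₃ ≫ G.δ n _ hS' := by rw [hs, a.naturality_assoc]
    _ = a.app S.X₃ ≫ G.δ n S hS := by rw [hG']; simp [φ, homOfShortExact]

theorem hom_ext (hF : F.IsEffaceable) {φ ψ : DeltaFunctor.Hom F G} (h₀ : φ.app 0 = ψ.app 0) :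
    φ = ψ := by
  refine DeltaFunctor.Hom.ext (funext fun n => ?_)
  induction n with
  | zero => exact h₀
  | succ n ih =>
    ext X
    obtain ⟨Y, u, hu, hu₀⟩ := hF n X
    have hS := shortExact_mk_cokernel u
    have := epi_δ hS hu₀
    rw [← cancel_epi (F.δ n _ hS), φ.comm n _ hS, ψ.comm n _ hS, ih]

theorem isUniversal (hF : F.IsEffaceable) : F.IsUniversal := by
  intro G f
  choose extend h_extend using fun n (a : F.F n ⟶ G.F n) => hF.exists_extension a
  let φ : ∀ n, F.F n ⟶ G.F n := fun n => Nat.rec f extend n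
  exact ⟨{ app := φ, comm := fun n => h_extend n (φ n) }, rfl, fun ψ hψ => hF.hom_ext hψ⟩

end IsEffaceable

end DeltaFunctor

end DeltaFunctors

section CochainComplexes

variable {𝓐 : Type u₁} [Category.{v₁} 𝓐] [Abelian 𝓐] {𝓑 : Type u₂} [Category.{v₂} 𝓑] [Abelian 𝓑]
  {𝓒 : Type u₃} [Category.{v₃} 𝓒] [Abelian 𝓒]

namespace DeltaFunctor

/-- The δ-functor formed by the cohomology of an exact functor to cochain complexes. -/
def ofCochainComplex (K : 𝓐 ⥤ CochainComplex 𝓑 ℕ) [K.Additive] [PreservesFiniteLimits K]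
    [PreservesFiniteColimits K] : DeltaFunctor 𝓐 𝓑 where
  F n := K ⋙ HomologicalComplex.homologyFunctor 𝓑 (ComplexShape.up ℕ) n
  δ n S hS := (hS.map_of_exact K).δ n (n + 1) rfl
  δ_naturality n {S S'} hS hS' φ := (HomologicalComplex.HomologySequence.δ_naturality
    (K.mapShortComplex.map φ) (hS.map_of_exact K) (hS'.map_of_exact K) n (n + 1) rfl).symm
  map_comp_δ n S hS := (hS.map_of_exact K).comp_δ n (n + 1) rfl
  δ_comp_map n S hS := (hS.map_of_exact K).δ_comp n (n + 1) rfl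
  mono S hS := by
    have := (hS.map_of_exact K).mono_f
    exact HomologicalComplex.mono_homologyMap_of_mono_of_not_rel (S.map K).f 0
      fun i => Nat.succ_ne_zero i
  exact₂ n S hS := (hS.map_of_exact K).homology_exact₂ n
  exact₃ n S hS := (hS.map_of_exact K).homology_exact₃ n (n + 1) rfl
  exact₁ n S hS := (hS.map_of_exact K).homology_exact₁ n (n + 1) rfl

/-- The morphism of δ-functors induced by a natural morphism of cochain complexes along an exact
functor. -/
def ofCochainComplexMap {K : 𝓐 ⥤ CochainComplex 𝓑 ℕ} [K.Additive] [PreservesFiniteLimits K]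
    [PreservesFiniteColimits K] {K' : 𝓒 ⥤ CochainComplex 𝓑 ℕ} [K'.Additive]
    [PreservesFiniteLimits K'] [PreservesFiniteColimits K'] (E : 𝓐 ⥤ 𝓒) [E.Additive]
    [PreservesFiniteLimits E] [PreservesFiniteColimits E] (α : K ⟶ E ⋙ K') :
    ofCochainComplex K ⟶ (ofCochainComplex K').precomp E where
  app n := Functor.whiskerRight α (HomologicalComplex.homologyFunctor 𝓑 (ComplexShape.up ℕ) n)
  comm n S hS := HomologicalComplex.HomologySequence.δ_naturality
    (ShortComplex.Hom.mk (S₁ := S.map K) (S₂ := (S.map E).map K') (α.app S.X₁) (α.app S.X₂)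
      (α.app S.X₃) (α.naturality S.f).symm (α.naturality S.g).symm)
    (hS.map_of_exact K) ((hS.map_of_exact E).map_of_exact K') n (n + 1) rfl

end DeltaFunctor

end CochainComplexes

/-! ### The Thomason complex on a fixed category -/

section ThomasonComplex

variable {A : Type u} [Category.{w} A]

/-- The natural systems on a fixed category `C`, as a functor to all natural systems. -/
def systemsOn (A : Type u) [Category.{w} A] (C : Type w) [SmallCategory C] :
    (SimplexCat C ⥤ A) ⥤ NatSystem A where
  obj T := ⟨C, T⟩
  map τ := NatSystem.Hom.mk (𝟭 C) { app f := τ.app f, naturality _ _ s := τ.naturality s }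

theorem NatSystem.hom_mk_ext {S T : NatSystem A} {φ : T.base ⥤ S.base}
    {τ τ' : SimplexCat.mapFunctor φ ⋙ S.system ⟶ T.system} (h : ∀ f, τ.app f = τ'.app f) :
    (NatSystem.Hom.mk φ τ : S ⟶ T) = NatSystem.Hom.mk φ τ' :=
  congrArg (NatSystem.Hom.mk φ) (NatTrans.ext (funext h))

/-- The morphism `(φ, 1)` of natural systems from `T` to its restriction along `Δ/φ`. -/
def systemRestriction (A : Type u) [Category.{w} A] {C₁ C₂ : Type w} [SmallCategory C₁]
    [SmallCategory C₂] (φ : C₂ ⥤ C₁) :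
    systemsOn A C₁ ⟶
      (Functor.whiskeringLeft _ _ A).obj (SimplexCat.mapFunctor φ) ⋙ systemsOn A C₂ where
  app T := NatSystem.Hom.mk φ (𝟙 (SimplexCat.mapFunctor φ ⋙ T))
  naturality T T' _ := NatSystem.hom_mk_ext (S := ⟨C₁, T⟩)
    (T := ⟨C₂, SimplexCat.mapFunctor φ ⋙ T'⟩)
    fun _ => (Category.comp_id _).trans (Category.id_comp _).symm

theorem systemRestriction_comp_map_trans {S T : NatSystem A} (a : S ⟶ T) :
    (systemRestriction A a.functor).app S.system ≫ (systemsOn A T.base).map a.trans = a :=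
  NatSystem.hom_mk_ext fun _ => Category.id_comp _

variable [Abelian A] [HasProducts.{w} A]

/-- The projection of the Thomason cochains onto the factor of a simplex. -/
def cochainπ (S : NatSystem A) {n : ℕ} (f : Fin (n + 1) ⥤ S.base) :
    ((thomasonComplex A).obj S).X n ⟶ S.system.obj ⟨SimplexCategory.mk n, f⟩ :=
  Pi.π (fun f : Fin (n + 1) ⥤ S.base => S.system.obj ⟨SimplexCategory.mk n, f⟩) f

/-- The morphism to the Thomason cochains with given components. -/
def cochainLift (S : NatSystem A) {n : ℕ} {X : A}
    (x : ∀ f : Fin (n + 1) ⥤ S.base, X ⟶ S.system.obj ⟨SimplexCategory.mk n, f⟩) :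
    X ⟶ ((thomasonComplex A).obj S).X n :=
  Pi.lift x

@[simp]
theorem cochainLift_π (S : NatSystem A) {n : ℕ} {X : A}
    (x : ∀ f : Fin (n + 1) ⥤ S.base, X ⟶ S.system.obj ⟨SimplexCategory.mk n, f⟩)
    (f : Fin (n + 1) ⥤ S.base) : cochainLift S x ≫ cochainπ S f = x f :=
  Pi.lift_π _ _

theorem cochain_ext (S : NatSystem A) {n : ℕ} {X : A} {x y : X ⟶ ((thomasonComplex A).obj S).X n}
    (h : ∀ f : Fin (n + 1) ⥤ S.base, x ≫ cochainπ S f = y ≫ cochainπ S f) : x = y :=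
  Pi.hom_ext _ _ h

@[simp]
theorem thomasonComplex_map_f_π {S T : NatSystem A} (a : S ⟶ T) {n : ℕ}
    (g : Fin (n + 1) ⥤ T.base) :
    ((thomasonComplex A).map a).f n ≫ cochainπ T g = cochainπ S (g ⋙ a.functor) ≫ a.at g :=
  Pi.lift_π _ _

/-- The `i`-th coface map of the cosimplicial replacement. -/
def cochainδ (S : NatSystem A) {n : ℕ} (i : Fin (n + 2)) :
    ((thomasonComplex A).obj S).X n ⟶ ((thomasonComplex A).obj S).X (n + 1) :=
  (cosimplicialReplacement S.system).δ i

@[simp]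
theorem cochainδ_π (S : NatSystem A) {n : ℕ} (i : Fin (n + 2)) (g : Fin (n + 2) ⥤ S.base) :
    cochainδ S i ≫ cochainπ S g = cochainπ S (toFunctor (SimplexCategory.δ i) ⋙ g) ≫
      S.system.map (SimplexCat.pull (SimplexCategory.δ i) g) :=
  Pi.lift_π _ _

theorem thomasonComplex_d_eq_sum (S : NatSystem A) (n : ℕ) :
    ((thomasonComplex A).obj S).d n (n + 1) =
      ∑ i : Fin (n + 2), (-1 : ℤ) ^ (i : ℕ) • cochainδ S i :=
  thomasonComplex_d A S n

theorem thomasonComplex_d_zero (S : NatSystem A) :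
    ((thomasonComplex A).obj S).d 0 1 = cochainδ S 0 - cochainδ S 1 := by
  simp [thomasonComplex_d_eq_sum, Fin.sum_univ_two, sub_eq_add_neg]

/-- The Thomason complex of the natural systems on a fixed category. -/
abbrev systemComplex (A : Type u) [Category.{w} A] [Abelian A] [HasProducts.{w} A] (C : Type w)
    [SmallCategory C] : (SimplexCat C ⥤ A) ⥤ CochainComplex A ℕ :=
  systemsOn A C ⋙ thomasonComplex A

variable (C : Type w) [SmallCategory C]

instance : (systemComplex A C).Additive where
  map_add {T T' τ τ'} := by
    ext n
    refine cochain_ext ((systemsOn A C).obj T') fun f => ?_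
    simp only [Functor.comp_map, HomologicalComplex.add_f_apply, Preadditive.add_comp,
      thomasonComplex_map_f_π]
    exact Preadditive.comp_add _ _ _ _ _ _

/-- The `n`-simplices of `C`, as a functor on a discrete category. -/
abbrev simplices (n : ℕ) : Discrete (Fin (n + 1) ⥤ C) ⥤ SimplexCat C :=
  Discrete.functor fun f => ⟨SimplexCategory.mk n, f⟩

variable {C}

/-- The Thomason cochains as the limit of the values on the simplices. -/
def systemComplexXIso (n : ℕ) (T : SimplexCat C ⥤ A) :
    ((systemComplex A C).obj T).X n ≅ lim.obj (simplices C n ⋙ T) :=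
  show lim.obj (Discrete.functor fun f : Fin (n + 1) ⥤ C => T.obj ⟨SimplexCategory.mk n, f⟩) ≅ _
  from lim.mapIso (Discrete.natIso fun _ => Iso.refl _)

theorem systemComplexXIso_hom_π (n : ℕ) (T : SimplexCat C ⥤ A)
    (f : Discrete (Fin (n + 1) ⥤ C)) :
    (systemComplexXIso n T).hom ≫ limit.π (simplices C n ⋙ T) f =
      cochainπ ((systemsOn A C).obj T) f.as :=
  (limMap_π _ f).trans (Category.comp_id _)

/-- The `n`-th cochain functor is restriction to the `n`-simplices followed by the product
functor. -/
def systemComplexEvalIso (A : Type u) [Category.{w} A] [Abelian A] [HasProducts.{w} A]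
    (C : Type w) [SmallCategory C] (n : ℕ) :
    systemComplex A C ⋙ HomologicalComplex.eval A (ComplexShape.up ℕ) n ≅
      (Functor.whiskeringLeft _ _ A).obj (simplices C n) ⋙ lim :=
  NatIso.ofComponents (systemComplexXIso n) fun {T T'} τ => by
    refine limit.hom_ext fun f => ?_
    have hT := systemComplexXIso_hom_π n T f
    have hT' := systemComplexXIso_hom_π n T' f
    refine Eq.trans ?_ ((thomasonComplex_map_f_π ((systemsOn A C).map τ) f.as).trans ?_)
    · exact (Category.assoc _ _ _).trans (congrArg (_ ≫ ·) hT')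
    · have h : lim.map (Functor.whiskerLeft (simplices C n) τ) ≫ limit.π (simplices C n ⋙ T') f =
          limit.π (simplices C n ⋙ T) f ≫ τ.app ((simplices C n).obj f) := limMap_π _ f
      exact (congrArg (· ≫ _) hT.symm).trans ((Category.assoc _ _ _).trans
        ((congrArg (_ ≫ ·) h.symm).trans (Category.assoc _ _ _).symm))

variable [AB4Star A]

instance : PreservesFiniteLimits (systemComplex A C) where
  preservesFiniteLimits _ _ _ := HomologicalComplex.preservesLimitsOfShape_of_eval _ fun n =>
    preservesLimitsOfShape_of_natIso (systemComplexEvalIso A C n).symm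

instance : PreservesFiniteColimits (systemComplex A C) where
  preservesFiniteColimits _ _ _ := HomologicalComplex.preservesColimitsOfShape_of_eval _ fun n =>
    preservesColimitsOfShape_of_natIso (systemComplexEvalIso A C n).symm

/-- Thomason cohomology of the natural systems on a fixed category, as a δ-functor. -/
abbrev thomasonDelta (A : Type u) [Category.{w} A] [Abelian A] [HasProducts.{w} A] [AB4Star A]
    (C : Type w) [SmallCategory C] : DeltaFunctor (SimplexCat C ⥤ A) A :=
  DeltaFunctor.ofCochainComplex (systemComplex A C)

end ThomasonComplex

section Coinduced

variable {D : Type u₁} [Category.{v₁} D] {A : Type u} [Category.{v₂} A]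

/-- The functor `c ↦ ∏_{c ⟶ d} T d`: its value on `T` is coinduced from the underlying family of
objects of `T`, and Thomason cohomology vanishes on it in positive degrees. -/
def coind (T : D ⥤ A) [∀ c : D, HasProduct fun p : Σ d : D, c ⟶ d => T.obj p.1] : D ⥤ A where
  obj c := ∏ᶜ fun p : Σ d : D, c ⟶ d => T.obj p.1
  map {c _} s := Pi.lift fun p => Pi.π (fun p : Σ d : D, c ⟶ d => T.obj p.1) ⟨p.1, s ≫ p.2⟩
  map_id c := Pi.hom_ext _ _ fun p => by
    rw [Pi.lift_π, Category.id_comp, Category.id_comp]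
  map_comp {c _ _} s t := Pi.hom_ext _ _ fun p => by
    rw [Category.assoc, Pi.lift_π, Pi.lift_π, Pi.lift_π, Category.assoc]

variable (T : D ⥤ A) [∀ c : D, HasProduct fun p : Σ d : D, c ⟶ d => T.obj p.1]

/-- The projection of a coinduced functor onto the factor of a morphism. -/
def coindπ {c d : D} (s : c ⟶ d) : (coind T).obj c ⟶ T.obj d :=
  Pi.π (fun p : Σ d : D, c ⟶ d => T.obj p.1) ⟨d, s⟩

theorem coind_map_π {c c' d : D} (s : c ⟶ c') (t : c' ⟶ d) :
    (coind T).map s ≫ coindπ T t = coindπ T (s ≫ t) :=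
  Pi.lift_π _ _

theorem coind_ext {c : D} {X : A} {x y : X ⟶ (coind T).obj c}
    (h : ∀ {d : D} (s : c ⟶ d), x ≫ coindπ T s = y ≫ coindπ T s) : x = y :=
  Pi.hom_ext _ _ fun p => h p.2

/-- The morphism into a coinduced functor with given components. -/
def coindLift {c : D} {X : A} (x : ∀ {d : D}, (c ⟶ d) → (X ⟶ T.obj d)) : X ⟶ (coind T).obj c :=
  Pi.lift fun p => x p.2

@[simp]
theorem coindLift_π {c d : D} {X : A} (x : ∀ {d : D}, (c ⟶ d) → (X ⟶ T.obj d)) (s : c ⟶ d) :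
    coindLift T x ≫ coindπ T s = x s :=
  Pi.lift_π _ _

/-- The embedding of a functor into the functor coinduced from its objects. -/
def coindUnit : T ⟶ coind T where
  app _ := coindLift T fun s => T.map s
  naturality c c' s := coind_ext T fun t => by
    rw [Category.assoc, Category.assoc, coind_map_π, coindLift_π, coindLift_π, T.map_comp]

instance : Mono (coindUnit T) := by
  have (c : D) : Mono ((coindUnit T).app c) :=
    have h : (coindUnit T).app c ≫ coindπ T (𝟙 c) = 𝟙 (T.obj c) :=
      (coindLift_π T _ _).trans (T.map_id c)
    (SplitMono.mk (coindπ T (𝟙 c)) h).mono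
  exact NatTrans.mono_of_mono_app _

end Coinduced

/-! ### Thomason cohomology is effaceable -/

section Effacement

open SSet.Augmented.StandardSimplex Simplicial

theorem δ_zero_comp_shift {n : ℕ} {Δ : SimplexCategory} (σ : ⦋n⦌ ⟶ Δ) :
    SimplexCategory.δ 0 ≫ shift σ = σ := by
  ext i : 3
  rfl

theorem δ_succ_comp_shift {n : ℕ} {Δ : SimplexCategory} (σ : ⦋n + 1⦌ ⟶ Δ) (i : Fin (n + 2)) :
    SimplexCategory.δ i.succ ≫ shift σ = shift (SimplexCategory.δ i ≫ σ) := by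
  ext j : 3
  cases j using Fin.cases with
  | zero => rfl
  | succ j =>
    change shiftFun _ (i.succ.succAbove j.succ) = σ.toOrderHom (i.succAbove j)
    rw [Fin.succ_succAbove_succ, shiftFun_succ]

theorem exact_of_comp_add_comp_eq_id {A : Type u} [Category.{v₁} A] [Abelian A]
    {S : ShortComplex A} (s : S.X₂ ⟶ S.X₁) (t : S.X₃ ⟶ S.X₂)
    (h : s ≫ S.f + S.g ≫ t = 𝟙 S.X₂) : S.Exact := by
  rw [ShortComplex.exact_iff_exact_up_to_refinements]
  intro X x hx
  have hx' : x = (x ≫ s) ≫ S.f := by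
    have := congrArg (x ≫ ·) h
    simp only [Preadditive.comp_add, ← Category.assoc, hx, zero_comp, add_zero,
      Category.comp_id] at this
    exact this.symm
  exact ⟨X, 𝟙 X, inferInstance, x ≫ s, (Category.id_comp x).trans hx'⟩

variable {A : Type u} [Category.{w} A] [Abelian A] [HasProducts.{w} A]
  {C : Type w} [SmallCategory C] (T : SimplexCat C ⥤ A)

/-- The natural system coinduced from a functor on the simplex category. -/
abbrev coindSystem : NatSystem A := (systemsOn A C).obj (coind T)

/-- The projection of the cochains of a coinduced system onto the factor of `σ : [n] ⟶ dim g`,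
regarded as a morphism of simplices `g ∘ σ ⟶ g`. -/
def coindCochainπ {n : ℕ} (g : SimplexCat C) (σ : ⦋n⦌ ⟶ g.dim) :
    ((thomasonComplex A).obj (coindSystem T)).X n ⟶ T.obj g :=
  cochainπ (coindSystem T) (toFunctor σ ⋙ g.simplex) ≫ coindπ T (SimplexCat.pull σ g.simplex)

theorem coindCochain_ext {n : ℕ} {X : A} {x y : X ⟶ ((thomasonComplex A).obj (coindSystem T)).X n}
    (h : ∀ (g : SimplexCat C) (σ : ⦋n⦌ ⟶ g.dim),
      x ≫ coindCochainπ T g σ = y ≫ coindCochainπ T g σ) : x = y := by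
  refine cochain_ext _ fun f => coind_ext T fun {g} s => ?_
  obtain ⟨(σ : ⦋n⦌ ⟶ g.dim), (hσ : f = toFunctor σ ⋙ g.simplex)⟩ := s
  subst hσ
  exact (Category.assoc _ _ _).trans ((h g σ).trans (Category.assoc _ _ _).symm)

theorem cochainδ_coindCochainπ {n : ℕ} (i : Fin (n + 2)) (g : SimplexCat C)
    (σ : ⦋n + 1⦌ ⟶ g.dim) :
    cochainδ (coindSystem T) i ≫ coindCochainπ T g σ =
      coindCochainπ T g (SimplexCategory.δ i ≫ σ) :=
  (Category.assoc _ _ _).symm.trans <| (congrArg (· ≫ _) (cochainδ_π _ i _)).trans <|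
    (Category.assoc _ _ _).trans (congrArg (_ ≫ ·) (coind_map_π T _ _))

theorem d_coindCochainπ {n : ℕ} (g : SimplexCat C) (σ : ⦋n + 1⦌ ⟶ g.dim) :
    ((thomasonComplex A).obj (coindSystem T)).d n (n + 1) ≫ coindCochainπ T g σ =
      ∑ i : Fin (n + 2), (-1 : ℤ) ^ (i : ℕ) • coindCochainπ T g (SimplexCategory.δ i ≫ σ) := by
  simp only [thomasonComplex_d_eq_sum, Preadditive.sum_comp, Preadditive.zsmul_comp,
    cochainδ_coindCochainπ]

/-- The contraction of the cochains of a coinduced system in positive degrees, induced by the extra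
degeneracy of the standard simplices. -/
def coindContraction (n : ℕ) :
    ((thomasonComplex A).obj (coindSystem T)).X (n + 1) ⟶
      ((thomasonComplex A).obj (coindSystem T)).X n :=
  cochainLift (coindSystem T) fun _ =>
    coindLift T fun {g} s => coindCochainπ T g (shift (SimplexCat.Hom.map s))

theorem coindContraction_π {n : ℕ} (g : SimplexCat C) (σ : ⦋n⦌ ⟶ g.dim) :
    coindContraction T n ≫ coindCochainπ T g σ = coindCochainπ T g (shift σ) :=
  (Category.assoc _ _ _).symm.trans <| (congrArg (· ≫ _) (cochainLift_π _ _ _)).trans <|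
    coindLift_π T _ _

theorem coindContraction_comp_d_add_d_comp_coindContraction (n : ℕ) :
    coindContraction T n ≫ ((thomasonComplex A).obj (coindSystem T)).d n (n + 1) +
      ((thomasonComplex A).obj (coindSystem T)).d (n + 1) (n + 2) ≫ coindContraction T (n + 1) =
      𝟙 _ := by
  refine coindCochain_ext T fun g σ => ?_
  rw [Preadditive.add_comp, Category.assoc, Category.assoc, d_coindCochainπ, coindContraction_π,
    d_coindCochainπ, Preadditive.comp_sum, Category.id_comp, Fin.sum_univ_succ (n := n + 2)]
  simp only [Preadditive.comp_zsmul, coindContraction_π, δ_succ_comp_shift, δ_zero_comp_shift,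
    Fin.val_zero, pow_zero, one_smul, Fin.val_succ, pow_succ, mul_neg, mul_one, neg_smul,
    Finset.sum_neg_distrib]
  abel

theorem isZero_homology_coindSystem (n : ℕ) :
    IsZero (((thomasonComplex A).obj (coindSystem T)).homology (n + 1)) := by
  refine HomologicalComplex.ExactAt.isZero_homology ?_
  rw [HomologicalComplex.exactAt_iff' _ n (n + 1) (n + 2) (by simp) (by simp)]
  exact exact_of_comp_add_comp_eq_id _ _ (coindContraction_comp_d_add_d_comp_coindContraction T n)

theorem thomasonDelta_isEffaceable [AB4Star A] : (thomasonDelta A C).IsEffaceable := fun n T =>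
  ⟨coind T, coindUnit T, inferInstance, (isZero_homology_coindSystem T n).eq_of_tgt _ _⟩

end Effacement

/-! ### Thomason cohomology in degree zero -/

section DegreeZero

open Simplicial

variable {A : Type u} [Category.{w} A] [Abelian A]

section Vertices

variable [HasProducts.{w} A] (S : NatSystem A)

/-- The component of a `0`-cochain at a simplex `g`, read off at a vertex of `g`. -/
def vertexπ (g : SimplexCat S.base) (v : ⦋0⦌ ⟶ g.dim) :
    ((thomasonComplex A).obj S).X 0 ⟶ S.system.obj g :=
  cochainπ S (toFunctor v ⋙ g.simplex) ≫ S.system.map (SimplexCat.pull v g.simplex)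

theorem vertexπ_map {g g' : SimplexCat S.base} (s : g ⟶ g') (v : ⦋0⦌ ⟶ g.dim) :
    vertexπ S g v ≫ S.system.map s = vertexπ S g' (v ≫ SimplexCat.Hom.map s) := by
  obtain ⟨n, g⟩ := g
  obtain ⟨(ρ : n ⟶ g'.dim), (hρ : g = toFunctor ρ ⋙ g'.simplex)⟩ := s
  subst hρ
  exact (Category.assoc _ _ _).trans (congrArg (_ ≫ ·) (S.system.map_comp _ _).symm)

theorem vertexπ_of_dim_zero (f : Fin (0 + 1) ⥤ S.base) (v : ⦋0⦌ ⟶ ⦋0⦌) :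
    vertexπ S ⟨⦋0⦌, f⟩ v = cochainπ S f := by
  obtain rfl : v = 𝟙 _ := Subsingleton.elim _ _
  exact (congrArg (_ ≫ ·) (S.system.map_id _)).trans (Category.comp_id _)

theorem cochainδ_π_map_pull (g : SimplexCat S.base) (e : ⦋1⦌ ⟶ g.dim) (i : Fin 2) :
    cochainδ S i ≫ cochainπ S (toFunctor e ⋙ g.simplex) ≫
      S.system.map (SimplexCat.pull e g.simplex) = vertexπ S g (SimplexCategory.δ i ≫ e) :=
  (Category.assoc _ _ _).symm.trans <| (congrArg (· ≫ _) (cochainδ_π S i _)).trans <|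
    vertexπ_map S (SimplexCat.pull e g.simplex) (SimplexCategory.δ i)

theorem d_π_map_pull (g : SimplexCat S.base) (e : ⦋1⦌ ⟶ g.dim) :
    ((thomasonComplex A).obj S).d 0 1 ≫ cochainπ S (toFunctor e ⋙ g.simplex) ≫
      S.system.map (SimplexCat.pull e g.simplex) =
        vertexπ S g (SimplexCategory.δ 0 ≫ e) - vertexπ S g (SimplexCategory.δ 1 ≫ e) := by
  rw [thomasonComplex_d_zero, Preadditive.sub_comp, cochainδ_π_map_pull, cochainδ_π_map_pull]

theorem δ_comp_mkOfLe {n : ℕ} (i j : Fin (n + 1)) (hij : i ≤ j) :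
    SimplexCategory.δ 1 ≫ SimplexCategory.mkOfLe i j hij = SimplexCategory.const ⦋0⦌ ⦋n⦌ i ∧
      SimplexCategory.δ 0 ≫ SimplexCategory.mkOfLe i j hij = SimplexCategory.const ⦋0⦌ ⦋n⦌ j := by
  constructor <;> · ext k : 3; fin_cases k; rfl

theorem comp_vertexπ_eq_of_comp_d_eq_zero {X : A} (x : X ⟶ ((thomasonComplex A).obj S).X 0)
    (hx : x ≫ ((thomasonComplex A).obj S).d 0 1 = 0) (g : SimplexCat S.base)
    (v v' : ⦋0⦌ ⟶ g.dim) : x ≫ vertexπ S g v = x ≫ vertexπ S g v' := by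
  have edge {i j : Fin (g.dim.len + 1)} (hij : i ≤ j) :
      x ≫ vertexπ S g (SimplexCategory.const ⦋0⦌ g.dim i) =
        x ≫ vertexπ S g (SimplexCategory.const ⦋0⦌ g.dim j) := by
    have h := congrArg (x ≫ ·) (d_π_map_pull S g (SimplexCategory.mkOfLe i j hij))
    obtain ⟨h₁, h₀⟩ := δ_comp_mkOfLe i j hij
    simp only [h₁, h₀, Preadditive.comp_sub, ← Category.assoc, hx, zero_comp] at h
    exact (sub_eq_zero.1 h.symm).symm
  rw [SimplexCategory.eq_const_of_zero v, SimplexCategory.eq_const_of_zero v']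
  rcases le_total (v.toOrderHom 0) (v'.toOrderHom 0) with h | h
  · exact edge h
  · exact (edge h).symm

end Vertices

variable [HasLimits A]

/-- The values of a compatible family on the `0`-simplices. -/
def limitToCochain (S : NatSystem A) : limit S.system ⟶ ((thomasonComplex A).obj S).X 0 :=
  cochainLift S fun f => limit.π S.system ⟨⦋0⦌, f⟩

theorem limitToCochain_π (S : NatSystem A) (f : Fin (0 + 1) ⥤ S.base) :
    limitToCochain S ≫ cochainπ S f = limit.π S.system ⟨⦋0⦌, f⟩ :=
  cochainLift_π S _ f

theorem limitToCochain_vertexπ (S : NatSystem A) (g : SimplexCat S.base) (v : ⦋0⦌ ⟶ g.dim) :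
    limitToCochain S ≫ vertexπ S g v = limit.π S.system g :=
  (Category.assoc _ _ _).symm.trans <| (congrArg (· ≫ _) (limitToCochain_π S _)).trans <|
    limit.w S.system (SimplexCat.pull v g.simplex)

theorem limitToCochain_d (S : NatSystem A) :
    limitToCochain S ≫ ((thomasonComplex A).obj S).d 0 1 = 0 := by
  refine cochain_ext S fun g => ?_
  have h (i : Fin 2) : limitToCochain S ≫ cochainδ S i ≫ cochainπ S g =
      limit.π S.system ⟨⦋1⦌, g⟩ :=
    (congrArg (_ ≫ ·) (cochainδ_π S i g)).trans
      (limitToCochain_vertexπ S ⟨⦋1⦌, g⟩ (SimplexCategory.δ i))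
  rw [thomasonComplex_d_zero, Category.assoc, Preadditive.sub_comp, Preadditive.comp_sub,
    h, h, sub_self, zero_comp]

/-- The compatible family of a `0`-cocycle. -/
def cocyclesToLimit (S : NatSystem A) : ((thomasonComplex A).obj S).cycles 0 ⟶ limit S.system :=
  limit.lift S.system
    { pt := ((thomasonComplex A).obj S).cycles 0
      π.app g := ((thomasonComplex A).obj S).iCycles 0 ≫
        vertexπ S g (SimplexCategory.const ⦋0⦌ g.dim 0)
      π.naturality g g' s := by
        refine (Category.id_comp _).trans (Eq.trans ?_ (Category.assoc _ _ _).symm)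
        rw [vertexπ_map]
        exact comp_vertexπ_eq_of_comp_d_eq_zero S _ (HomologicalComplex.iCycles_d _ 0 1) g' _ _ }

theorem cocyclesToLimit_π (S : NatSystem A) (g : SimplexCat S.base) (v : ⦋0⦌ ⟶ g.dim) :
    cocyclesToLimit S ≫ limit.π S.system g =
      ((thomasonComplex A).obj S).iCycles 0 ≫ vertexπ S g v :=
  (limit.lift_π _ _).trans
    (comp_vertexπ_eq_of_comp_d_eq_zero S _ (HomologicalComplex.iCycles_d _ 0 1) g _ _)

/-- The identification of compatible families with `0`-cocycles. -/
def limitIsoCocycles (S : NatSystem A) :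
    limit S.system ≅ ((thomasonComplex A).obj S).cycles 0 where
  hom := ((thomasonComplex A).obj S).liftCycles (limitToCochain S) 1 (by simp) (limitToCochain_d S)
  inv := cocyclesToLimit S
  hom_inv_id := limit.hom_ext fun g => by
    rw [Category.assoc, cocyclesToLimit_π S g (SimplexCategory.const ⦋0⦌ g.dim 0),
      HomologicalComplex.liftCycles_i_assoc, limitToCochain_vertexπ, Category.id_comp]
  inv_hom_id := by
    rw [← cancel_mono (((thomasonComplex A).obj S).iCycles 0), Category.assoc,
      HomologicalComplex.liftCycles_i, Category.id_comp]
    refine cochain_ext S fun f => ?_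
    rw [Category.assoc, limitToCochain_π, cocyclesToLimit_π S ⟨⦋0⦌, f⟩ (𝟙 _),
      vertexπ_of_dim_zero]

theorem limitIsoCocycles_hom_iCycles (S : NatSystem A) :
    (limitIsoCocycles S).hom ≫ ((thomasonComplex A).obj S).iCycles 0 = limitToCochain S :=
  HomologicalComplex.liftCycles_i _ (limitToCochain S) 1 (by simp) (limitToCochain_d S)

theorem limitToCochain_map {S T : NatSystem A} (a : S ⟶ T) (l : limit S.system ⟶ limit T.system)
    (hl : ∀ f, l ≫ limit.π T.system f =
      limit.π S.system ((SimplexCat.mapFunctor a.functor).obj f) ≫ a.trans.app f) :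
    limitToCochain S ≫ ((thomasonComplex A).map a).f 0 = l ≫ limitToCochain T := by
  refine cochain_ext T fun f => ?_
  rw [Category.assoc, Category.assoc, thomasonComplex_map_f_π, limitToCochain_π]
  exact (Category.assoc _ _ _).symm.trans <|
    (congrArg (· ≫ _) (limitToCochain_π S _)).trans (hl ⟨⦋0⦌, f⟩).symm

/-- Thomason cohomology in degree `0` is the limit. -/
def limitIsoCohomology (S : NatSystem A) : limit S.system ≅ (thomasonCohomology A 0).obj S :=
  limitIsoCocycles S ≪≫ CochainComplex.isoHomologyπ₀ _

theorem limitIsoCohomology_hom_naturality {S T : NatSystem A} (a : S ⟶ T)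
    (l : limit S.system ⟶ limit T.system)
    (hl : ∀ f, l ≫ limit.π T.system f =
      limit.π S.system ((SimplexCat.mapFunctor a.functor).obj f) ≫ a.trans.app f) :
    (limitIsoCohomology S).hom ≫ (thomasonCohomology A 0).map a =
      l ≫ (limitIsoCohomology T).hom := by
  have cocycles : (limitIsoCocycles S).hom ≫
      HomologicalComplex.cyclesMap ((thomasonComplex A).map a) 0 =
        l ≫ (limitIsoCocycles T).hom := by
    rw [← cancel_mono (((thomasonComplex A).obj T).iCycles 0), Category.assoc, Category.assoc,
      HomologicalComplex.cyclesMap_i, limitIsoCocycles_hom_iCycles, ← limitToCochain_map a l hl,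
      ← limitIsoCocycles_hom_iCycles, Category.assoc]
  have homology : ((thomasonComplex A).obj S).homologyπ 0 ≫ (thomasonCohomology A 0).map a =
      HomologicalComplex.cyclesMap ((thomasonComplex A).map a) 0 ≫
        ((thomasonComplex A).obj T).homologyπ 0 :=
    HomologicalComplex.homologyπ_naturality _ _
  exact (Category.assoc _ _ _).trans <| (congrArg (_ ≫ ·) homology).trans <|
    (Category.assoc _ _ _).symm.trans <| (congrArg (· ≫ _) cocycles).trans (Category.assoc _ _ _)

end DegreeZero

/-! ### Derived limits -/

section DerivedLimits

namespace RightDerived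

variable {𝓐 : Type u₁} [Category.{v₁} 𝓐] [Abelian 𝓐] {𝓑 : Type u₂} [Category.{v₂} 𝓑] [Abelian 𝓑]
  {L : 𝓐 ⥤ 𝓑}

/-- The comparison of two choices of the right derived functors of `L`. -/
def uniqueIso (R R' : RightDerived L) : R.delta ≅ R'.delta :=
  R.universal.isoOfIsoZero R'.universal (R.iso ≪≫ R'.iso.symm)

theorem uniqueIso_hom_app_zero (R R' : RightDerived L) :
    (R.uniqueIso R').hom.app 0 = R.iso.hom ≫ R'.iso.inv :=
  R.universal.lift_zero _ _

end RightDerived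

theorem limRestrict_comp_uniqueIso_hom {A : Type u} [Category.{w} A] [Abelian A] [HasLimits A]
    {D₁ D₂ : Type w} [SmallCategory D₁] [SmallCategory D₂] (Φ : D₂ ⥤ D₁)
    (R₁ R₁' : RightDerived (lim : (D₁ ⥤ A) ⥤ A)) (R₂ R₂' : RightDerived (lim : (D₂ ⥤ A) ⥤ A)) :
    (limRestrict Φ R₁ R₂ : R₁.delta ⟶ _) ≫
        (DeltaFunctor.precompFunctor A ((Functor.whiskeringLeft D₂ D₁ A).obj Φ)).map
          (R₂.uniqueIso R₂').hom =
      (R₁.uniqueIso R₁').hom ≫ limRestrict Φ R₁' R₂' := by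
  refine (R₁.universal.lift_comp _ _).trans (Eq.trans ?_
    (R₁.universal.comp_lift R₁'.universal _ _).symm)
  let E := (Functor.whiskeringLeft D₂ D₁ A).obj Φ
  have left : Functor.whiskerLeft E R₂.iso.inv ≫
      Functor.whiskerLeft E ((R₂.uniqueIso R₂').hom.app 0) = Functor.whiskerLeft E R₂'.iso.inv := by
    rw [← Functor.whiskerLeft_comp, RightDerived.uniqueIso_hom_app_zero, Iso.inv_hom_id_assoc]
  have right : (R₁.uniqueIso R₁').hom.app 0 ≫ R₁'.iso.hom = R₁.iso.hom := by
    rw [RightDerived.uniqueIso_hom_app_zero, Category.assoc, Iso.inv_hom_id, Category.comp_id]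
  refine congrArg (R₁.universal.lift _) ((Category.assoc _ _ _).trans ?_)
  refine (congrArg (R₁.iso.hom ≫ ·)
    ((Category.assoc _ _ _).trans (congrArg (limPre A Φ ≫ ·) left))).trans ?_
  exact (congrArg (· ≫ limPre A Φ ≫ Functor.whiskerLeft E R₂'.iso.inv) right).symm.trans
    (Category.assoc _ _ _)

variable {A : Type u} [Category.{w} A] [Abelian A] [HasLimits A]

/-- Any two choices of the derived limits agree, naturally in the natural system. -/
def DerivedLimits.functorIso (L L' : DerivedLimits A) (n : ℕ) : L.functor n ≅ L'.functor n :=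
  NatIso.ofComponents
    (fun S => ((DeltaFunctor.degree _ A n).mapIso ((L S.base).uniqueIso (L' S.base))).app S.system)
    fun {S T} a => by
      have restriction := congrArg (fun γ => (DeltaFunctor.Hom.app γ n).app S.system)
        (limRestrict_comp_uniqueIso_hom (SimplexCat.mapFunctor a.functor) (L S.base) (L' S.base)
          (L T.base) (L' T.base))
      have naturality := (((L T.base).uniqueIso (L' T.base)).hom.app n).naturality a.trans
      exact (Category.assoc _ _ _).trans <| (congrArg (_ ≫ ·) naturality).trans <|
        (Category.assoc _ _ _).symm.trans <| (congrArg (· ≫ _) restriction).trans <|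
          Category.assoc _ _ _

variable [AB4Star A]

/-- Thomason cohomology, as the right derived functors of the limit. -/
def thomasonRightDerived (A : Type u) [Category.{w} A] [Abelian A] [HasLimits A] [AB4Star A] :
    DerivedLimits A := fun C _ =>
  { delta := thomasonDelta A C
    universal := (thomasonDelta_isEffaceable (A := A) (C := C)).isUniversal
    iso := Iso.symm <| NatIso.ofComponents
      (fun T => limitIsoCohomology ((systemsOn A C).obj T)) fun {_ _} τ =>
        (limitIsoCohomology_hom_naturality ((systemsOn A C).map τ) (lim.map τ)
          fun f => limMap_π τ f).symm }

theorem limRestrict_thomasonRightDerived {C₁ C₂ : Type w} [SmallCategory C₁] [SmallCategory C₂]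
    (φ : C₂ ⥤ C₁) :
    limRestrict (SimplexCat.mapFunctor φ) (thomasonRightDerived A C₁) (thomasonRightDerived A C₂) =
      DeltaFunctor.ofCochainComplexMap
        ((Functor.whiskeringLeft _ _ A).obj (SimplexCat.mapFunctor φ))
        (Functor.whiskerRight (systemRestriction A φ) (thomasonComplex A)) := by
  refine (thomasonRightDerived A C₁).universal.hom_ext (NatTrans.ext (funext fun T => ?_))
  refine (limRestrict_zero _ _ _ T).trans ((Iso.inv_comp_eq (limitIsoCohomology _)).2 ?_)
  refine (limitIsoCohomology_hom_naturality ((systemRestriction A φ).app T)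
    (limit.pre T (SimplexCat.mapFunctor φ)) fun f => ?_).symm
  exact (limit.pre_π _ _ _).trans (Category.comp_id _).symm

/-- Thomason cohomology is the derived limit formed by `thomasonRightDerived`, also as a functor of
the natural system. -/
def thomasonCohomologyIsoFunctor (A : Type u) [Category.{w} A] [Abelian A] [HasLimits A]
    [AB4Star A] (n : ℕ) : thomasonCohomology A n ≅ (thomasonRightDerived A).functor n :=
  NatIso.ofComponents (fun _ => Iso.refl _) fun {S T} a => by
    have restriction := congrArg (fun γ => (DeltaFunctor.Hom.app γ n).app S.system)
      (limRestrict_thomasonRightDerived (A := A) a.functor)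
    refine (Category.comp_id _).trans (Eq.trans ?_ (Category.id_comp _).symm)
    refine Eq.trans ?_ (congrArg (· ≫ _) restriction).symm
    exact (congrArg (thomasonCohomology A n).map (systemRestriction_comp_map_trans a)).symm.trans
      ((thomasonCohomology A n).map_comp _ _)

/-- Thomason cohomology computes the derived limits. -/
def thomasonCohomologyIso (L : DerivedLimits A) (n : ℕ) : thomasonCohomology A n ≅ L.functor n :=
  thomasonCohomologyIsoFunctor A n ≪≫ (thomasonRightDerived A).functorIso L n

end DerivedLimits

/-! ### Extra degeneracies -/

section ExtraDegeneracy

open AlgebraicTopology SimplicialObject.Augmented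

variable {B : Type u₁} [Category.{v₁} B] [Preadditive B] [HasZeroObject B]

/-- The augmentation of the alternating face map complex of an augmented simplicial object. -/
def augmentation (X : SimplicialObject.Augmented B) :
    AlternatingFaceMapComplex.obj (drop.obj X) ⟶ (ChainComplex.single₀ B).obj (point.obj X) :=
  AlternatingFaceMapComplex.ε.app X

theorem augmentation_f_zero (X : SimplicialObject.Augmented B) :
    (augmentation X).f 0 = X.hom.app (op (SimplexCategory.mk 0)) :=
  AlternatingFaceMapComplex.ε_app_f_zero X

variable {B' : Type u₂} [Category.{v₂} B'] [Preadditive B'] (F : B ⥤ B') [F.Additive]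

/-- An additive functor commutes with the formation of the alternating face map complex. -/
def mapAlternatingFaceMapComplexIso (X : SimplicialObject.Augmented B) :
    (F.mapHomologicalComplex _).obj (AlternatingFaceMapComplex.obj (drop.obj X)) ≅
      AlternatingFaceMapComplex.obj (drop.obj (((whiskering B B').obj F).obj X)) :=
  HomologicalComplex.Hom.isoOfComponents (fun _ => Iso.refl _) (by
    rintro _ n rfl
    have h : F.map ((AlternatingFaceMapComplex.obj (drop.obj X)).d (n + 1) n) =
        (AlternatingFaceMapComplex.obj (drop.obj (((whiskering B B').obj F).obj X))).d
          (n + 1) n := by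
      simp only [AlternatingFaceMapComplex.obj_d_eq, Functor.map_sum, Functor.map_zsmul]
      rfl
    exact (Category.id_comp _).trans (h.symm.trans (Category.comp_id _).symm))

theorem quasiIso_map_augmentation [HasZeroObject B'] [CategoryWithHomology B']
    (X : SimplicialObject.Augmented B) (ed : ExtraDegeneracy (((whiskering B B').obj F).obj X)) :
    QuasiIso ((F.mapHomologicalComplex _).map (augmentation X)) := by
  let X' := ((whiskering B B').obj F).obj X
  have hX' : QuasiIso (augmentation X') := ed.homotopyEquiv.quasiIso_hom
  let e₁ := mapAlternatingFaceMapComplexIso F X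
  let e₂ : (F.mapHomologicalComplex _).obj ((ChainComplex.single₀ B).obj (point.obj X)) ≅
      (ChainComplex.single₀ B').obj (point.obj X') :=
    (HomologicalComplex.singleMapHomologicalComplex F _ 0).app (point.obj X)
  have comm : (F.mapHomologicalComplex _).map (augmentation X) ≫ e₂.hom =
      e₁.hom ≫ augmentation X' := by
    refine HomologicalComplex.to_single_hom_ext ?_
    have he₂ : e₂.hom.f 0 = 𝟙 _ :=
      (HomologicalComplex.singleMapHomologicalComplex_hom_app_self F (.down ℕ) 0 _).trans
        ((Category.comp_id _).trans (F.map_id _))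
    have hε : F.map ((augmentation X).f 0) = (augmentation X').f 0 := by
      rw [augmentation_f_zero, augmentation_f_zero]
      exact (Category.comp_id _).symm
    exact (congrArg (_ ≫ ·) he₂).trans <| (Category.comp_id _).trans <|
      hε.trans (Category.id_comp _).symm
  have : QuasiIso ((F.mapHomologicalComplex _).map (augmentation X) ≫ e₂.hom) := by
    rw [comm]
    infer_instance
  exact quasiIso_of_comp_right _ e₂.hom

theorem quasiIso_augmentation {D : Type u₃} [Category.{v₃} D] {B : Type u₁} [Category.{v₁} B]
    [Abelian B] (X : SimplicialObject.Augmented (D ⥤ B))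
    (ed : ∀ d, ExtraDegeneracy (((whiskering _ _).obj ((evaluation D B).obj d)).obj X)) :
    QuasiIso (augmentation X) :=
  (HomologicalComplex.quasiIso_iff_evaluation _).2 fun d =>
    quasiIso_map_augmentation ((evaluation D B).obj d) X (ed d)

end ExtraDegeneracy

/-! ### The bar resolution -/

section Bar

open SSet.Augmented.StandardSimplex Simplicial

variable (C : Type w) [SmallCategory C]

/-- The dimension functor `Δ/C ⥤ Δ`. -/
def dimension : SimplexCat C ⥤ SimplexCategory where
  obj f := f.dim
  map s := SimplexCat.Hom.map s

/-- The simplicial system `[n] ↦ (f ↦ ℤ[Δ^{dim f}]ₙ)` on `Δ/C`. -/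
def barSimplicial : SimplicialObject (SimplexCat C ⥤ AddCommGrpCat.{w}) :=
  (dimension C ⋙ SSet.stdSimplex.{w} ⋙
    (SimplicialObject.whiskering _ _).obj AddCommGrpCat.free).flip

/-- The system `f ↦ ℤ[Δ^{dim f}]ₙ` on `Δ/C` of the `n`-chains of the bar resolution. -/
abbrev barObj (n : SimplexCategory) : SimplexCat C ⥤ AddCommGrpCat.{w} :=
  (barSimplicial C).obj (op n)

variable {C} {n : SimplexCategory}

/-- The generator of `barObj C n` given by a simplex of the standard simplex. -/
def barGen {g : SimplexCat C} (σ : n ⟶ g.dim) : (barObj C n).obj g :=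
  FreeAbelianGroup.of (ULift.up.{w} σ)

theorem barObj_obj_hom_ext {g : SimplexCat C} {G : AddCommGrpCat.{w}}
    {a b : (barObj C n).obj g ⟶ G} (h : ∀ σ : n ⟶ g.dim, a (barGen σ) = b (barGen σ)) : a = b :=
  AddCommGrpCat.hom_ext (FreeAbelianGroup.lift_ext _ _ fun σ => h σ.down)

theorem barObj_map_gen {g g' : SimplexCat C} (s : g ⟶ g') (σ : n ⟶ g.dim) :
    (barObj C n).map s (barGen σ) = barGen (σ ≫ SimplexCat.Hom.map s) :=
  FreeAbelianGroup.map_of_apply _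

theorem barSimplicial_map_gen {m : SimplexCategory} (ρ : m ⟶ n) {g : SimplexCat C}
    (σ : n ⟶ g.dim) : ((barSimplicial C).map ρ.op).app g (barGen σ) = barGen (ρ ≫ σ) :=
  FreeAbelianGroup.map_of_apply _

/-- The universal generator of `barObj C n` at a simplex `f` of dimension `n`. -/
abbrev barGenId (f : Fin (n.len + 1) ⥤ C) : (barObj C n).obj ⟨n, f⟩ :=
  barGen (g := ⟨n, f⟩) (𝟙 n)

theorem barObj_map_pull_barGenId {g : SimplexCat C} (σ : n ⟶ g.dim) :
    (barObj C n).map (SimplexCat.pull σ g.simplex) (barGenId (toFunctor σ ⋙ g.simplex)) =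
      barGen σ :=
  (barObj_map_gen _ _).trans (congrArg barGen (Category.id_comp σ))

/-- By the Yoneda lemma a natural transformation out of `barObj C n` is a family of elements
indexed by the `n`-dimensional simplices of `C`. -/
def barDesc (M : SimplexCat C ⥤ AddCommGrpCat.{w})
    (y : ∀ f : Fin (n.len + 1) ⥤ C, M.obj ⟨n, f⟩) : barObj C n ⟶ M where
  app g := AddCommGrpCat.ofHom (FreeAbelianGroup.lift fun σ =>
    M.map (SimplexCat.pull σ.down g.simplex) (y (toFunctor σ.down ⋙ g.simplex)))
  naturality g g' s := by
    obtain ⟨m, g⟩ := g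
    obtain ⟨(ρ : m ⟶ g'.dim), (rfl : g = toFunctor ρ ⋙ g'.simplex)⟩ := s
    refine barObj_obj_hom_ext fun σ => ?_
    refine (congrArg (FreeAbelianGroup.lift _) (barObj_map_gen _ σ)).trans ?_
    refine (FreeAbelianGroup.lift_apply_of _ _).trans (Eq.symm ?_)
    refine (congrArg (M.map _) (FreeAbelianGroup.lift_apply_of _ _)).trans ?_
    exact (ConcreteCategory.congr_hom (M.map_comp _ _) _).symm

theorem barDesc_genId (M : SimplexCat C ⥤ AddCommGrpCat.{w})
    (y : ∀ f : Fin (n.len + 1) ⥤ C, M.obj ⟨n, f⟩) (f : Fin (n.len + 1) ⥤ C) :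
    (barDesc M y).app ⟨n, f⟩ (barGenId f) = y f :=
  (FreeAbelianGroup.lift_apply_of _ _).trans (ConcreteCategory.congr_hom (M.map_id _) _)

theorem barObj_hom_ext {M : SimplexCat C ⥤ AddCommGrpCat.{w}} {a b : barObj C n ⟶ M}
    (h : ∀ f : Fin (n.len + 1) ⥤ C,
      a.app ⟨n, f⟩ (barGenId f) = b.app ⟨n, f⟩ (barGenId f)) : a = b := by
  refine NatTrans.ext (funext fun g => barObj_obj_hom_ext fun σ => ?_)
  have app_gen (e : barObj C n ⟶ M) : e.app g (barGen σ) =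
      M.map (SimplexCat.pull σ g.simplex) (e.app _ (barGenId (toFunctor σ ⋙ g.simplex))) :=
    (congrArg (e.app g) (barObj_map_pull_barGenId σ).symm).trans
      (ConcreteCategory.congr_hom (e.naturality (SimplexCat.pull σ g.simplex)) _)
  rw [app_gen a, app_gen b, h]

instance : Projective (barObj C n) where
  factors {E X} f e _ := by
    have he (c) : Function.Surjective (e.app c) :=
      (AddCommGrpCat.epi_iff_surjective _).1 inferInstance
    choose y hy using fun f₀ : Fin (n.len + 1) ⥤ C => he ⟨n, f₀⟩ (f.app ⟨n, f₀⟩ (barGenId f₀))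
    exact ⟨barDesc E y, barObj_hom_ext fun f₀ =>
      (congrArg (e.app _) (barDesc_genId E y f₀)).trans (hy f₀)⟩

/-- The augmentation `ℤ[Δ^{dim f}]ₙ ⟶ ℤ`, which sends every generator to `1`. -/
def barAug (n : SimplexCategory) : barObj C n ⟶ constZ (SimplexCat C) :=
  barDesc _ fun _ => ULift.up (1 : ℤ)

theorem barAug_gen {g : SimplexCat C} (σ : n ⟶ g.dim) :
    (barAug n).app g (barGen σ) = ULift.up.{w} (1 : ℤ) :=
  FreeAbelianGroup.lift_apply_of _ _

variable (C) in
/-- The simplicial system `ℤ[Δ^{dim f}]` augmented over the constant system `ℤ`. -/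
def barAugmented : SimplicialObject.Augmented (SimplexCat C ⥤ AddCommGrpCat.{w}) where
  left := barSimplicial C
  right := constZ (SimplexCat C)
  hom :=
    { app := fun n => barAug n.unop
      naturality := fun n m ρ => by
        ext g : 2
        refine barObj_obj_hom_ext fun σ => ?_
        refine (congrArg ((barAug m.unop).app g) (barSimplicial_map_gen ρ.unop σ)).trans ?_
        exact (barAug_gen _).trans (barAug_gen σ).symm }

theorem uliftInt_hom_ext {G : AddCommGrpCat.{w}} {a b : AddCommGrpCat.of (ULift.{w} ℤ) ⟶ G}
    (h : a (ULift.up 1) = b (ULift.up 1)) : a = b := by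
  have e : a.hom.comp AddEquiv.ulift.symm.toAddMonoidHom =
      b.hom.comp AddEquiv.ulift.symm.toAddMonoidHom := AddMonoidHom.ext_int h
  exact AddCommGrpCat.hom_ext (AddMonoidHom.ext fun x => DFunLike.congr_fun e x.down)

/-- The section `ℤ ⟶ ℤ[Δ^{dim g}]₀` of the augmentation given by the initial vertex. -/
def barSection (g : SimplexCat C) :
    AddCommGrpCat.of (ULift.{w} ℤ) ⟶ (barObj C ⦋0⦌).obj g :=
  AddCommGrpCat.ofHom ((zmultiplesHom ((barObj C ⦋0⦌).obj g)
    (barGen (SimplexCategory.const ⦋0⦌ g.dim 0))).comp AddEquiv.ulift.toAddMonoidHom)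

theorem barSection_one (g : SimplexCat C) :
    barSection g (ULift.up.{w} (1 : ℤ)) = barGen (SimplexCategory.const ⦋0⦌ g.dim 0) :=
  one_zsmul _

theorem barSection_comp_barAug (g : SimplexCat C) :
    barSection g ≫ (barAug ⦋0⦌).app g = 𝟙 _ := by
  have h : (barAug ⦋0⦌).app g (barSection g (ULift.up.{w} (1 : ℤ))) =
      ULift.up.{w} (1 : ℤ) :=
    (congrArg _ (barSection_one g)).trans (barAug_gen _)
  exact uliftInt_hom_ext h

/-- On `Δ^{dim g}` the extra degeneracy is the usual contraction to the initial vertex. -/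
def barExtraDegeneracy (g : SimplexCat C) :
    SimplicialObject.Augmented.ExtraDegeneracy
      (((SimplicialObject.Augmented.whiskering _ _).obj ((evaluation _ _).obj g)).obj
        (barAugmented C)) :=
  let ed := (SSet.Augmented.StandardSimplex.extraDegeneracy.{w} g.dim).map AddCommGrpCat.free
  { s' := barSection g
    s := ed.s
    s'_comp_ε := barSection_comp_barAug g
    s₀_comp_δ₁ := by
      refine barObj_obj_hom_ext fun σ => ?_
      refine (ConcreteCategory.congr_hom ed.s₀_comp_δ₁ (barGen σ)).trans ?_
      refine (congrArg ed.s' (FreeAbelianGroup.map_of_apply _)).trans ?_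
      refine (FreeAbelianGroup.map_of_apply _).trans ?_
      exact ((congrArg (barSection g) (barAug_gen σ)).trans (barSection_one g)).symm
    s_comp_δ₀ := ed.s_comp_δ₀
    s_comp_δ := ed.s_comp_δ
    s_comp_σ := ed.s_comp_σ }

variable (C) in
/-- The bar resolution of the constant functor `ℤ` on `Δ/C`. -/
def barResolution : ProjectiveResolution (constZ (SimplexCat C)) where
  complex := AlgebraicTopology.AlternatingFaceMapComplex.obj (barSimplicial C)
  projective n := inferInstanceAs (Projective (barObj C ⦋n⦌))
  π := augmentation (barAugmented C)
  quasiIso := quasiIso_augmentation _ barExtraDegeneracy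

end Bar

section BarCochains

open Simplicial

variable {A : Type u} [Category.{w} A] [Abelian A] [HasLimits A]

theorem symHom_barObj_ext {C : Type w} [SmallCategory C] (T : SimplexCat C ⥤ A)
    {n : SimplexCategory} {X : A} {x y : X ⟶ (symHom T).obj (op (barObj C n))}
    (h : ∀ f : Fin (n.len + 1) ⥤ C, x ≫ symEval T (barObj C n) ⟨n, f⟩ (barGenId f) =
      y ≫ symEval T (barObj C n) ⟨n, f⟩ (barGenId f)) : x = y := by
  apply ((symHomAdj T).homEquiv X (op (barObj C n))).symm.injective
  rw [Adjunction.homEquiv_counit, Adjunction.homEquiv_counit]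
  exact Quiver.Hom.unop_inj (barObj_hom_ext h)

variable (S : NatSystem A)

/-- Symbolic homs out of `barObj` are Thomason cochains. -/
def barCochainIso (n : ℕ) :
    (symHom S.system).obj (op (barObj S.base ⦋n⦌)) ≅ ((thomasonComplex A).obj S).X n where
  hom := cochainLift S fun f => symEval S.system (barObj S.base ⦋n⦌) ⟨⦋n⦌, f⟩ (barGenId f)
  inv := symLift S.system (barObj S.base ⦋n⦌) _
    (barDesc ((homInto S.system).obj _).unop fun f => cochainπ S f)
  hom_inv_id := symHom_barObj_ext S.system fun f => by
    refine (Category.assoc _ _ _).trans <| (congrArg (_ ≫ ·) <|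
      (symLift_eval _ _ _ _ _ _).trans (barDesc_genId _ _ f)).trans ?_
    exact (cochainLift_π S _ f).trans (Category.id_comp _).symm
  inv_hom_id := cochain_ext S fun f => by
    refine (Category.assoc _ _ _).trans <| (congrArg (_ ≫ ·) (cochainLift_π S _ f)).trans ?_
    exact (symLift_eval _ _ _ _ _ _).trans <| (barDesc_genId _ _ f).trans
      (Category.id_comp _).symm

theorem barCochainIso_hom_π {n : ℕ} (f : Fin (n + 1) ⥤ S.base) :
    (barCochainIso S n).hom ≫ cochainπ S f =
      symEval S.system (barObj S.base ⦋n⦌) ⟨⦋n⦌, f⟩ (barGenId f) :=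
  cochainLift_π S _ f

theorem barCochainIso_hom_cochainδ {n : ℕ} (i : Fin (n + 2)) :
    (barCochainIso S n).hom ≫ cochainδ S i =
      (symHom S.system).map ((barSimplicial S.base).δ i).op ≫ (barCochainIso S (n + 1)).hom := by
  refine cochain_ext S fun f => ?_
  let f' := toFunctor (SimplexCategory.δ i) ⋙ f
  have face_genId : ((barSimplicial S.base).δ i).app ⟨⦋n + 1⦌, f⟩ (barGenId f) =
      (barObj S.base ⦋n⦌).map (SimplexCat.pull (SimplexCategory.δ i) f) (barGenId f') :=
    (barSimplicial_map_gen (SimplexCategory.δ i) _).trans <|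
      (congrArg barGen (Category.comp_id _)).trans
        (barObj_map_pull_barGenId (g := ⟨⦋n + 1⦌, f⟩) (SimplexCategory.δ i)).symm
  calc ((barCochainIso S n).hom ≫ cochainδ S i) ≫ cochainπ S f
      = ((barCochainIso S n).hom ≫ cochainπ S f') ≫
          S.system.map (SimplexCat.pull (SimplexCategory.δ i) f) :=
        (Category.assoc _ _ _).trans <|
          (congrArg (_ ≫ ·) (cochainδ_π S i f)).trans (Category.assoc _ _ _).symm
    _ = symEval S.system (barObj S.base ⦋n⦌) ⟨⦋n⦌, f'⟩ (barGenId f') ≫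
          S.system.map (SimplexCat.pull (SimplexCategory.δ i) f) :=
        congrArg (· ≫ _) (barCochainIso_hom_π S f')
    _ = symEval S.system (barObj S.base ⦋n⦌) ⟨⦋n + 1⦌, f⟩
          (((barSimplicial S.base).δ i).app ⟨⦋n + 1⦌, f⟩ (barGenId f)) :=
        (symEval_map _ _ _ _).symm.trans (congrArg _ face_genId.symm)
    _ = (symHom S.system).map ((barSimplicial S.base).δ i).op ≫
          symEval S.system (barObj S.base ⦋n + 1⦌) ⟨⦋n + 1⦌, f⟩ (barGenId f) :=
        (symHom_map_eval _ _ _ _).symm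
    _ = _ := (congrArg (_ ≫ ·) (barCochainIso_hom_π S f).symm).trans (Category.assoc _ _ _).symm

theorem homComplex_barResolution_d (n : ℕ) :
    (homComplex S.system (barResolution S.base).complex).d n (n + 1) =
      ∑ i : Fin (n + 2), (-1 : ℤ) ^ (i : ℕ) •
        (symHom S.system).map ((barSimplicial S.base).δ i).op := by
  refine (congrArg (fun a => (symHom S.system).map a.op)
    (AlgebraicTopology.AlternatingFaceMapComplex.obj_d_eq (barSimplicial S.base) n)).trans ?_
  simp only [op_sum, op_zsmul, Functor.map_sum, Functor.map_zsmul]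

/-- The symbolic hom complex of the bar resolution is the Thomason complex. -/
def barHomComplexIso :
    homComplex S.system (barResolution S.base).complex ≅ (thomasonComplex A).obj S :=
  HomologicalComplex.Hom.isoOfComponents (barCochainIso S) (by
    rintro n _ rfl
    rw [thomasonComplex_d_eq_sum, homComplex_barResolution_d]
    refine (Preadditive.comp_sum _ _ _).trans <| Eq.trans ?_ (Preadditive.sum_comp _ _ _).symm
    refine Finset.sum_congr rfl fun i _ => ?_
    refine (Preadditive.comp_zsmul _ _ _).trans <| Eq.trans ?_ (Preadditive.zsmul_comp _ _ _).symm
    exact congrArg _ (barCochainIso_hom_cochainδ S i))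

end BarCochains

section BarComparison

open Simplicial

variable {A : Type u} [Category.{w} A]

theorem barResolution_complex_d_app {C : Type w} [SmallCategory C] (n : ℕ) (g : SimplexCat C) :
    ((barResolution C).complex.d (n + 1) n).app g =
      ∑ i : Fin (n + 2), (-1 : ℤ) ^ (i : ℕ) • ((barSimplicial C).δ i).app g := by
  refine (congrArg (fun a => NatTrans.app a g)
    (AlgebraicTopology.AlternatingFaceMapComplex.obj_d_eq (barSimplicial C) n)).trans ?_
  simp only [NatTrans.app_sum, NatTrans.app_zsmul]

/-- The bar resolution only depends on the dimension of the simplices, so that it restricts to the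
bar resolution. -/
def barComparison {S T : NatSystem A} (a : S ⟶ T) :
    (barResolution T.base).complex ⟶
      restrict (SimplexCat.mapFunctor a.functor) (barResolution S.base).complex where
  f n :=
    { app := fun g => 𝟙 ((barObj T.base ⦋n⦌).obj g)
      naturality := fun _ _ s => (𝟙 (barObj T.base ⦋n⦌) :).naturality s }
  comm' := by
    rintro _ n rfl
    ext g : 2
    refine (Category.id_comp _).trans <| Eq.trans ?_ (Category.comp_id _).symm
    exact (barResolution_complex_d_app n ((SimplexCat.mapFunctor a.functor).obj g)).trans
      (barResolution_complex_d_app n g).symm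

theorem resAug_barResolution (C : Type w) [SmallCategory C] :
    resAug (barResolution C) = barAug ⦋0⦌ :=
  augmentation_f_zero (barAugmented C)

theorem isComparison_barComparison {S T : NatSystem A} (a : S ⟶ T) :
    IsComparison (SimplexCat.mapFunctor a.functor) (barResolution S.base) (barResolution T.base)
      (barComparison a) := by
  refine NatTrans.ext (funext fun g => ?_)
  refine (Category.id_comp _).trans <| Eq.trans ?_ (Category.comp_id _).symm
  exact (congrArg (fun γ => NatTrans.app γ ((SimplexCat.mapFunctor a.functor).obj g))
    (resAug_barResolution S.base)).trans
    (congrArg (fun γ => NatTrans.app γ g) (resAug_barResolution T.base)).symm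

variable [Abelian A] [HasLimits A]

theorem homComplexMap_barComparison_comp_barHomComplexIso_hom {S T : NatSystem A} (a : S ⟶ T) :
    homComplexMap (SimplexCat.mapFunctor a.functor) a.trans (barComparison a) ≫
        (barHomComplexIso T).hom = (barHomComplexIso S).hom ≫ (thomasonComplex A).map a := by
  ext n
  refine cochain_ext T fun f => ?_
  refine (Category.assoc _ _ _).trans <| (congrArg (_ ≫ ·) (barCochainIso_hom_π T f)).trans ?_
  refine (symMap_eval _ _ _ _ _).trans (Eq.symm ?_)
  refine (Category.assoc _ _ _).trans <|
    (congrArg (_ ≫ ·) (thomasonComplex_map_f_π a f)).trans ?_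
  refine (Category.assoc _ _ _).symm.trans ?_
  exact congrArg (· ≫ _) (barCochainIso_hom_π S _)

end BarComparison

/-! ### Independence of the resolution -/

section ChangeOfResolution

variable {A : Type u} [Category.{w} A] [Abelian A] [HasLimits A]

/-- The morphism induced by a morphism of natural systems on the cohomology of the symbolic hom
complexes of arbitrary resolutions of `ℤ`; `extMap` is the case of the chosen resolutions. -/
def resolutionMap {S T : NatSystem A} (a : S ⟶ T)
    (P : ProjectiveResolution (constZ (SimplexCat S.base)))
    (Q : ProjectiveResolution (constZ (SimplexCat T.base))) (n : ℕ) :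
    (homComplex S.system P.complex).homology n ⟶ (homComplex T.system Q.complex).homology n :=
  HomologicalComplex.homologyMap (homComplexMap (SimplexCat.mapFunctor a.functor) a.trans
    (exists_isOver Q (restrictRes (SimplexCat.mapFunctor a.functor) P)
      (𝟙 (constZ (SimplexCat T.base)))).choose) n

theorem resolutionMap_eq {S T : NatSystem A} (a : S ⟶ T)
    {P : ProjectiveResolution (constZ (SimplexCat S.base))}
    {Q : ProjectiveResolution (constZ (SimplexCat T.base))}
    {α : Q.complex ⟶ restrict (SimplexCat.mapFunctor a.functor) P.complex}
    (hα : IsComparison _ P Q α) (n : ℕ) :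
    resolutionMap a P Q n = HomologicalComplex.homologyMap (homComplexMap _ a.trans α) n :=
  homologyMap_homComplexMap_eq _ _ (exists_isOver Q
    (restrictRes (SimplexCat.mapFunctor a.functor) P) (𝟙 _)).choose_spec hα n

theorem resolutionMap_id (S : NatSystem A)
    (P : ProjectiveResolution (constZ (SimplexCat S.base))) (n : ℕ) :
    resolutionMap (𝟙 S) P P n = 𝟙 _ := by
  rw [resolutionMap_eq (𝟙 S) (isComparison_id S P), homComplexMap_id,
    HomologicalComplex.homologyMap_id]

theorem resolutionMap_comp {R S T : NatSystem A} (a : R ⟶ S) (b : S ⟶ T)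
    (P : ProjectiveResolution (constZ (SimplexCat R.base)))
    (Q : ProjectiveResolution (constZ (SimplexCat S.base)))
    (Q' : ProjectiveResolution (constZ (SimplexCat T.base))) (n : ℕ) :
    resolutionMap a P Q n ≫ resolutionMap b Q Q' n = resolutionMap (a ≫ b) P Q' n := by
  obtain ⟨α, hα⟩ := exists_isOver Q (restrictRes (SimplexCat.mapFunctor a.functor) P) (𝟙 _)
  obtain ⟨β, hβ⟩ := exists_isOver Q' (restrictRes (SimplexCat.mapFunctor b.functor) Q) (𝟙 _)
  rw [resolutionMap_eq a hα, resolutionMap_eq b hβ,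
    resolutionMap_eq (a ≫ b) (isComparison_comp a b hα hβ)]
  exact (HomologicalComplex.homologyMap_comp _ _ _).symm.trans
    (congrArg (fun γ => HomologicalComplex.homologyMap γ n) (homComplexMap_comp a b α β).symm)

/-- The comparison of the cohomologies of the symbolic hom complexes of two resolutions of `ℤ`. -/
def resolutionIso (S : NatSystem A) (P Q : ProjectiveResolution (constZ (SimplexCat S.base)))
    (n : ℕ) :
    (homComplex S.system P.complex).homology n ≅ (homComplex S.system Q.complex).homology n where
  hom := resolutionMap (𝟙 S) P Q n
  inv := resolutionMap (𝟙 S) Q P n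
  hom_inv_id := by rw [resolutionMap_comp, Category.comp_id, resolutionMap_id]
  inv_hom_id := by rw [resolutionMap_comp, Category.comp_id, resolutionMap_id]

theorem resolutionMap_comp_resolutionIso_hom {S T : NatSystem A} (a : S ⟶ T)
    (P P' : ProjectiveResolution (constZ (SimplexCat S.base)))
    (Q Q' : ProjectiveResolution (constZ (SimplexCat T.base))) (n : ℕ) :
    resolutionMap a P Q n ≫ (resolutionIso T Q Q' n).hom =
      (resolutionIso S P P' n).hom ≫ resolutionMap a P' Q' n := by
  refine (resolutionMap_comp _ _ _ _ _ _).trans (Eq.trans ?_ (resolutionMap_comp _ _ _ _ _ _).symm)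
  rw [Category.comp_id, Category.id_comp]

theorem resolutionMap_barResolution_comp {S T : NatSystem A} (a : S ⟶ T) (n : ℕ) :
    resolutionMap a (barResolution S.base) (barResolution T.base) n ≫
        HomologicalComplex.homologyMap (barHomComplexIso T).hom n =
      HomologicalComplex.homologyMap (barHomComplexIso S).hom n ≫
        (thomasonCohomology A n).map a := by
  rw [resolutionMap_eq a (isComparison_barComparison a), ← HomologicalComplex.homologyMap_comp,
    homComplexMap_barComparison_comp_barHomComplexIso_hom]
  exact HomologicalComplex.homologyMap_comp _ _ _

variable (A) in
/-- `Extⁿ(ℤ, T)`, computed by the bar resolution, is the Thomason cohomology of `T`. -/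
def extIsoThomason (n : ℕ) : extFunctor A n ≅ thomasonCohomology A n :=
  NatIso.ofComponents
    (fun S => resolutionIso S (projectiveResolution (constZ (SimplexCat S.base)))
      (barResolution S.base) n ≪≫
        (HomologicalComplex.homologyFunctor A _ n).mapIso (barHomComplexIso S))
    fun {S T} a => by
      let P (S : NatSystem A) := projectiveResolution (constZ (SimplexCat S.base))
      have h := resolutionMap_comp_resolutionIso_hom a (P S) (barResolution S.base) (P T)
        (barResolution T.base) n
      refine (Category.assoc _ _ _).symm.trans <| (congrArg (· ≫ _) h).trans ?_
      exact (Category.assoc _ _ _).trans <|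
        (congrArg (_ ≫ ·) (resolutionMap_barResolution_comp a n)).trans (Category.assoc _ _ _).symm

end ChangeOfResolution

end Thomason

end

theorem mainTheorem1 {A : Type u} [Category.{w} A] [Abelian A] [HasLimits A] [AB4Star A] :
    (∀ n : ℕ, Nonempty (Thomason.thomasonCohomology A n ≅ Thomason.extFunctor A n)) ∧
    Nonempty (Thomason.DerivedLimits A) ∧
    ∀ (L : Thomason.DerivedLimits A) (n : ℕ),
      Nonempty (Thomason.extFunctor A n ≅ L.functor n) :=
  ⟨fun n => ⟨(Thomason.extIsoThomason A n).symm⟩,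
    ⟨Thomason.thomasonRightDerived A⟩,
    fun L n => ⟨Thomason.extIsoThomason A n ≪≫ Thomason.thomasonCohomologyIso L n⟩⟩
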